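/- Let $G$ be a finite, simple, connected graph with edges $e_1,\dots,e_m$, and let $K$ be any field. Let $\mathcal A_G=\{\mathbf a_1,\dots,\mathbf a_m\}\subset\mathbb Z^{V(G)}$, where $\mathbf a_i$ has entry $1$ at the two end points of $e_i$ and $0$ elsewhere, let $\ker_{\mathbb Z}(\mathcal A_G)=\{\mathbf u\in\mathbb Z^m : \sum_i u_i\mathbf a_i=\mathbf 0\}$, and let $$I_{\mathcal A_G}=\big(\mathbf x^{\mathbf u_+}-\mathbf x^{\mathbf u_-} : \mathbf u\in\ker_{\mathbb Z}(\mathcal A_G)\big)\subset K[x_1,\dots,x_m]$$ be the toric ideal of $G$, where $\mathbf u_+,\mathbf u_-$ are the positive and negative parts of $\mathbf u$. A binomial is a difference of two distinct monomials. We use the following notions. - A binomial is a *minimal binomial* of $I_{\mathcal A_G}$ if it belongs to some inclusion-minimal system of binomial generators of $I_{\mathcal A_G}$. A monomial $M$ is *indispensable* of $I_{\mathcal A_G}$ if every system of binomial generators of $I_{\mathcal A_G}$ contains a binomial in which $M$ occurs. - A *circuit* is a binomial $\mathbf x^{\mathbf u_+}-\mathbf x^{\mathbf u_-}$, where $\mathbf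 0\neq\mathbf u\in\ker_{\mathbb Z}(\mathcal A_G)$ has coprime coordinates and no nonzero $\mathbf v\in\ker_{\mathbb Z}(\mathcal A_G)$ has support strictly contained in the support of $\mathbf u$. - For an even closed walk $w=(e_{i_1},\dots,e_{i_{2s}})$ of $G$, put $B_w=B_w^{(+)}-B_w^{(-)}$ with $B_w^{(+)}=\prod_{k=1}^s x_{i_{2k-1}}$ and $B_w^{(-)}=\prod_{k=1}^s x_{i_{2k}}$. - $\mu(I_{\mathcal A_G})$ is the minimal number of generators of $I_{\mathcal A_G}$, i.e. the least cardinality of a system of binomial generators. $\mathrm{bar}(I_{\mathcal A_G})$ is the binomial arithmetical rank, i.e. the smallest $s$ for which there are binomials $B_1,\dots,B_s\in I_{\mathcal A_G}$ with $\mathrm{rad}(I_{\mathcal A_G})=\mathrm{rad}(B_1,\dots,B_s)$. Assume that $G$ satisfies $(\sharp)$ no induced subgraph of $G$ consists of two vertex-disjoint odd cycles joined by a path of length $\geq 1$ (the path meeting the two cycles only in its end points), and that there is no even closed walk $w$ of $G$ such that $B_w$ is both a minimal binomial of $I_{\mathcal A_G}$ and a circuit, and $B_w^{(+)}$ and $B_w^{(-)}$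 are both squarefree and both not indispensable of $I_{\mathcal A_G}$. Then $$\mathrm{bar}(I_{\mathcal A_G})=\mu(I_{\mathcal A_G}).$$ -/

import Mathlib

open scoped BigOperators

namespace ToricGraph

noncomputable section

/-! ### Binomials, generating systems, indispensable monomials -/

/-- A binomial: a difference of two (distinct) monomials, with coefficients `1` and `-1`. -/
def IsBinomial {σ K : Type*} [Field K] (f : MvPolynomial σ K) : Prop :=
  ∃ u v : σ →₀ ℕ, u ≠ v ∧ f = MvPolynomial.monomial u 1 - MvPolynomial.monomial v 1

/-- A system of binomial generators of the ideal `I`. -/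
def IsBinomialSystem {σ K : Type*} [Field K] (I : Ideal (MvPolynomial σ K))
    (S : Set (MvPolynomial σ K)) : Prop :=
  (∀ f ∈ S, IsBinomial f) ∧ Ideal.span S = I

/-- A minimal binomial of `I`: a member of some inclusion-minimal system of binomial
generators of `I`. -/
def IsMinimalBinomial {σ K : Type*} [Field K] (I : Ideal (MvPolynomial σ K))
    (f : MvPolynomial σ K) : Prop :=
  ∃ S : Set (MvPolynomial σ K), Minimal (IsBinomialSystem I) S ∧ f ∈ S

/-- The monomial with exponent vector `m` is indispensable of `I`: every system of binomial
generators of `I` contains a binomial in which this monomial occurs. -/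
def IsIndispensableMonomial {σ K : Type*} [Field K] (I : Ideal (MvPolynomial σ K))
    (m : σ →₀ ℕ) : Prop :=
  ∀ S : Set (MvPolynomial σ K), IsBinomialSystem I S → ∃ f ∈ S, m ∈ f.support

/-- The monomial with exponent vector `m` is squarefree. -/
def IsSquarefreeExp {σ : Type*} (m : σ →₀ ℕ) : Prop := ∀ i, m i ≤ 1

/-- The minimal number of generators: the least cardinality of a system of binomial
generators of `I`. -/
def mu {σ K : Type*} [Field K] (I : Ideal (MvPolynomial σ K)) : ℕ :=
  sInf {s : ℕ | ∃ S : Finset (MvPolynomial σ K),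
    IsBinomialSystem I (S : Set (MvPolynomial σ K)) ∧ S.card = s}

/-- The binomial arithmetical rank: the least `s` such that there are binomials
`B₁, …, Bₛ` in `I` with `rad I = rad (B₁, …, Bₛ)`. -/
def bar {σ K : Type*} [Field K] (I : Ideal (MvPolynomial σ K)) : ℕ :=
  sInf {s : ℕ | ∃ B : Fin s → MvPolynomial σ K,
    (∀ i, IsBinomial (B i) ∧ B i ∈ I) ∧ I.radical = (Ideal.span (Set.range B)).radical}

/-! ### Lattice ideals, toric ideals, circuits -/

/-- The positive part `u₊` of an integer vector, as an exponent vector. -/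
def posExp {σ : Type*} [Finite σ] (u : σ → ℤ) : σ →₀ ℕ :=
  Finsupp.equivFunOnFinite.symm fun i => (u i).toNat

/-- The negative part `u₋` of an integer vector, as an exponent vector. -/
def negExp {σ : Type*} [Finite σ] (u : σ → ℤ) : σ →₀ ℕ :=
  Finsupp.equivFunOnFinite.symm fun i => (-u i).toNat

/-- The polynomial `x^{u₊} - x^{u₋}`. -/
def vecBinomial {σ : Type*} [Finite σ] (K : Type*) [Field K] (u : σ → ℤ) :
    MvPolynomial σ K :=
  MvPolynomial.monomial (posExp u) 1 - MvPolynomial.monomial (negExp u) 1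

/-- The lattice ideal of a lattice `L` in `ℤ^σ`. -/
def latticeIdeal {σ : Type*} [Finite σ] (K : Type*) [Field K] (L : AddSubgroup (σ → ℤ)) :
    Ideal (MvPolynomial σ K) :=
  Ideal.span {f | ∃ u ∈ L, f = vecBinomial K u}

/-- The lattice of integer relations of a vector configuration `A`. -/
def kerZ {σ τ : Type*} [Fintype σ] (A : σ → τ → ℤ) : AddSubgroup (σ → ℤ) where
  carrier := {q | ∑ i, q i • A i = 0}
  zero_mem' := by simp
  add_mem' := by
    intro a b ha hb
    simp only [Set.mem_ofPred_eq, Pi.add_apply, add_smul, Finset.sum_add_distrib] at ha hb ⊢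
    rw [ha, hb, add_zero]
  neg_mem' := by
    intro a ha
    simp only [Set.mem_ofPred_eq, Pi.neg_apply, neg_smul, Finset.sum_neg_distrib] at ha ⊢
    rw [ha, neg_zero]

/-- The toric ideal of a vector configuration `A`. -/
def toricIdeal {σ τ : Type*} [Fintype σ] (K : Type*) [Field K] (A : σ → τ → ℤ) :
    Ideal (MvPolynomial σ K) :=
  latticeIdeal K (kerZ A)

/-- A circuit vector of `A`: a nonzero integer relation with coprime coordinates whose support
is minimal among the supports of the nonzero relations. -/
def IsCircuitVector {σ τ : Type*} [Fintype σ] (A : σ → τ → ℤ) (u : σ → ℤ) : Prop :=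
  u ∈ kerZ A ∧ u ≠ 0 ∧
    (∀ v ∈ kerZ A, v ≠ 0 → ¬ Function.support v ⊂ Function.support u) ∧
    Finset.univ.gcd u = 1

/-- A circuit (as a binomial) of the toric ideal of `A`. -/
def IsCircuit {σ τ K : Type*} [Fintype σ] [Field K] (A : σ → τ → ℤ)
    (f : MvPolynomial σ K) : Prop :=
  ∃ u : σ → ℤ, IsCircuitVector A u ∧ f = vecBinomial K u

/-! ### Graphs -/

/-- The vector configuration of a graph: the edge `{v, w}` gives the vector with entries `1`
at `v` and `w` and `0` elsewhere. -/
def edgeVectors {V : Type*} [DecidableEq V] (G : SimpleGraph V) : G.edgeSet → V → ℤ :=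
  fun e v => if v ∈ (e : Sym2 V) then 1 else 0

/-- The toric ideal of a graph, with one variable for each edge. -/
def graphIdeal {V : Type*} [Fintype V] [DecidableEq V] (K : Type*) [Field K]
    (G : SimpleGraph V) [DecidableRel G.Adj] : Ideal (MvPolynomial G.edgeSet K) :=
  toricIdeal K (edgeVectors G)

/-- For a walk `(e₁, e₂, …)`, the exponent vector of `x_{e₁} x_{e₃} x_{e₅} ⋯`
(list positions start at `0`). -/
def walkPlus {V : Type*} {G : SimpleGraph V} {a b : V} (w : G.Walk a b) : G.edgeSet →₀ ℕ :=
  ∑ i : Fin w.darts.length,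
    if Even (i : ℕ) then Finsupp.single ⟨(w.darts.get i).edge, (w.darts.get i).edge_mem⟩ 1 else 0

/-- For a walk `(e₁, e₂, …)`, the exponent vector of `x_{e₂} x_{e₄} x_{e₆} ⋯`. -/
def walkMinus {V : Type*} {G : SimpleGraph V} {a b : V} (w : G.Walk a b) : G.edgeSet →₀ ℕ :=
  ∑ i : Fin w.darts.length,
    if Odd (i : ℕ) then Finsupp.single ⟨(w.darts.get i).edge, (w.darts.get i).edge_mem⟩ 1 else 0

/-- The polynomial `B_w = B_w^{(+)} - B_w^{(-)}` (used for even closed walks `w`). -/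
def walkBinomial {V : Type*} {G : SimpleGraph V} (K : Type*) [Field K] {a b : V}
    (w : G.Walk a b) : MvPolynomial G.edgeSet K :=
  MvPolynomial.monomial (walkPlus w) 1 - MvPolynomial.monomial (walkMinus w) 1

/-- Condition (♯): no induced subgraph consists of two vertex-disjoint odd cycles
(`c₁` through `a`, `c₂` through `b`) joined by a path `p` of length at least `1` from `a` to `b`
that meets the two cycles only in its end points. That the subgraph is induced says that every
edge of the graph between its vertices is an edge of `c₁`, of `c₂` or of `p`. -/
def SatisfiesSharp {V : Type*} (G : SimpleGraph V) : Prop :=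
  ¬ ∃ (a b : V) (c₁ : G.Walk a a) (c₂ : G.Walk b b) (p : G.Walk a b),
    c₁.IsCycle ∧ Odd c₁.length ∧ c₂.IsCycle ∧ Odd c₂.length ∧ p.IsPath ∧ 1 ≤ p.length ∧
    (∀ x ∈ c₁.support, x ∉ c₂.support) ∧
    (∀ x ∈ p.support, x ∈ c₁.support → x = a) ∧
    (∀ x ∈ p.support, x ∈ c₂.support → x = b) ∧
    (∀ x y : V, (x ∈ c₁.support ∨ x ∈ c₂.support ∨ x ∈ p.support) →
      (y ∈ c₁.support ∨ y ∈ c₂.support ∨ y ∈ p.support) → G.Adj x y →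
      (s(x, y) ∈ c₁.edges ∨ s(x, y) ∈ c₂.edges ∨ s(x, y) ∈ p.edges))

end

end ToricGraph

/-! Monomials in the edge variables are graded by their vertex degrees `vdeg`; a binomial lies in
the toric ideal exactly when its two monomials lie in the same fibre of `vdeg`. Inside a fibre, join
two monomials when they share a variable, and let `Linked` be the resulting connectivity. Two linked
monomials differ by an element generated in lower degree (`mem_span_of_linked`), so each binomial of
a least system of generators joins two different components of its fibre.

Condition (♯) controls unlinked pairs. A minimal alternating closed walk that is neither an even
cycle nor two odd cycles with one common vertex contains two disjoint odd cycles joined by a walk.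
An edge leaving one of these cycles away from its base point splits the pair of monomials and links
it; if there is no such edge, shortest choices produce the induced subgraph that (♯) forbids. Hence
unlinked pairs are of the two simple types (`circlePair_of_not_linked`), and these give squarefree
circuits. The hypothesis on minimal binomials then makes one of the two monomials indispensable, and
so isolated: it shares no variable with any other monomial of its fibre.

For the lower bound, let binomials cut out the ideal up to radical. Evaluation at the indicator of
the support of an isolated monomial shows that one of them has a monomial supported there
(`exists_support_subset`). A binomial touches at most two isolated monomials, all in one fibre
(`Touches.eq_of_three`, `Touches.vdeg_eq`), so the count can be made fibre by fibre. A fibre with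
one generator has an isolated monomial and costs one binomial. A fibre with more generators contains
three pairwise unlinked monomials; they are then the whole fibre (`eq_of_unlinked`) and are all
isolated, so there are exactly two generators, and two binomials are needed. The other inequality is
immediate. -/

namespace ToricGraph

/-! ### Alternating monomials of walks and vertex degrees -/

section WalkAlgebra

variable {V : Type*} {G : SimpleGraph V}

/-- The exponent vector of a single edge variable. -/
noncomputable def edgeExp {a b : V} (h : G.Adj a b) : G.edgeSet →₀ ℕ :=
  Finsupp.single ⟨s(a, b), h⟩ 1

lemma edgeExp_symm {a b : V} (h : G.Adj a b) : edgeExp h.symm = edgeExp h := by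
  simp only [edgeExp]
  congr 2
  exact Sym2.eq_swap

lemma edgeExp_apply [DecidableEq V] {a b : V} (h : G.Adj a b) (e : G.edgeSet) :
    edgeExp h e = if (e : Sym2 V) = s(a, b) then 1 else 0 := by
  rw [edgeExp, Finsupp.single_apply]
  exact if_congr (by rw [eq_comm, Subtype.ext_iff]) rfl rfl

lemma edgeExp_ne_zero {a b : V} (h : G.Adj a b) : edgeExp h ≠ 0 := by
  simp [edgeExp]

@[simp] lemma walkPlus_nil (a : V) : walkPlus (SimpleGraph.Walk.nil : G.Walk a a) = 0 := by
  simp [walkPlus]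

@[simp] lemma walkMinus_nil (a : V) : walkMinus (SimpleGraph.Walk.nil : G.Walk a a) = 0 := by
  simp [walkMinus]

lemma walkPlus_cons {a b c : V} (h : G.Adj a b) (p : G.Walk b c) :
    walkPlus (p.cons h) = edgeExp h + walkMinus p := by
  have key : ∀ (l : List G.Dart) (d : G.Dart),
      (∑ i : Fin (d :: l).length, if Even (i : ℕ) then
        Finsupp.single (⟨((d :: l).get i).edge, ((d :: l).get i).edge_mem⟩ : G.edgeSet) 1 else 0) =
      Finsupp.single ⟨d.edge, d.edge_mem⟩ 1 + ∑ i : Fin l.length, if Odd (i : ℕ) then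
        Finsupp.single (⟨(l.get i).edge, (l.get i).edge_mem⟩ : G.edgeSet) 1 else 0 := by
    intro l d
    refine (Fin.sum_univ_succ _).trans ?_
    simp [Nat.even_add_one]
  exact key p.darts ⟨(a, b), h⟩

lemma walkMinus_cons {a b c : V} (h : G.Adj a b) (p : G.Walk b c) :
    walkMinus (p.cons h) = walkPlus p := by
  have key : ∀ (l : List G.Dart) (d : G.Dart),
      (∑ i : Fin (d :: l).length, if Odd (i : ℕ) then
        Finsupp.single (⟨((d :: l).get i).edge, ((d :: l).get i).edge_mem⟩ : G.edgeSet) 1 else 0) =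
      ∑ i : Fin l.length, if Even (i : ℕ) then
        Finsupp.single (⟨(l.get i).edge, (l.get i).edge_mem⟩ : G.edgeSet) 1 else 0 := by
    intro l d
    refine (Fin.sum_univ_succ _).trans ?_
    simp [Nat.odd_add_one]
  exact key p.darts ⟨(a, b), h⟩

lemma walkPlus_append {a b c : V} (p : G.Walk a b) (q : G.Walk b c) :
    walkPlus (p.append q) = walkPlus p + if Even p.length then walkPlus q else walkMinus q := by
  -- Removing the first edge exchanges `walkPlus` and `walkMinus`, so the induction carries both
  -- formulas.
  suffices H : walkPlus (p.append q) =
        walkPlus p + (if Even p.length then walkPlus q else walkMinus q) ∧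
      walkMinus (p.append q) =
        walkMinus p + (if Even p.length then walkMinus q else walkPlus q) from H.1
  induction p with
  | nil => simp
  | cons h p ih =>
    simp only [SimpleGraph.Walk.cons_append, walkPlus_cons, walkMinus_cons, (ih q).1, (ih q).2,
      SimpleGraph.Walk.length_cons, Nat.even_add_one]
    split_ifs <;> simp_all [add_assoc]

lemma walkMinus_append {a b c : V} (p : G.Walk a b) (q : G.Walk b c) :
    walkMinus (p.append q) = walkMinus p + if Even p.length then walkMinus q else walkPlus q := by
  induction p with
  | nil => simp
  | cons h p ih =>
    simp only [SimpleGraph.Walk.cons_append, walkMinus_cons, walkPlus_append,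
      SimpleGraph.Walk.length_cons, Nat.even_add_one]
    split_ifs <;> simp_all

lemma walkPlus_reverse {a b : V} (p : G.Walk a b) :
    walkPlus p.reverse = if Even p.length then walkMinus p else walkPlus p := by
  suffices H : walkPlus p.reverse = (if Even p.length then walkMinus p else walkPlus p) ∧
      walkMinus p.reverse = (if Even p.length then walkPlus p else walkMinus p) from H.1
  induction p with
  | nil => simp
  | cons h p ih =>
    have hs := edgeExp_symm h
    simp only [SimpleGraph.Walk.reverse_cons, walkPlus_append, walkMinus_append, walkPlus_cons,
      walkMinus_cons, SimpleGraph.Walk.length_cons, Nat.even_add_one,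
      SimpleGraph.Walk.length_reverse, ih.1, ih.2, walkPlus_nil, walkMinus_nil, hs]
    split_ifs <;> simp_all [add_comm]

lemma walkMinus_reverse {a b : V} (p : G.Walk a b) :
    walkMinus p.reverse = if Even p.length then walkPlus p else walkMinus p := by
  induction p with
  | nil => simp
  | cons h p ih =>
    have hs := edgeExp_symm h
    simp only [SimpleGraph.Walk.reverse_cons, walkMinus_append, walkPlus_cons,
      walkMinus_cons, SimpleGraph.Walk.length_cons, Nat.even_add_one,
      SimpleGraph.Walk.length_reverse, ih, walkPlus_nil, walkMinus_nil, hs]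
    split_ifs <;> simp_all [add_comm]

lemma mem_edges_iff {a b : V} (p : G.Walk a b) (e : G.edgeSet) :
    (e : Sym2 V) ∈ p.edges ↔ walkPlus p e ≠ 0 ∨ walkMinus p e ≠ 0 := by
  induction p with
  | nil => simp
  | @cons u v w h p ih =>
    classical
    simp only [SimpleGraph.Walk.edges_cons, List.mem_cons, ih, walkPlus_cons, walkMinus_cons,
      Finsupp.add_apply, edgeExp_apply]
    by_cases h1 : (e : Sym2 V) = s(u, v)
    · simp [h1]
    · simp only [h1, if_false, zero_add, false_or]
      tauto

lemma mem_edges_of_walkPlus {a b : V} {p : G.Walk a b} {e : G.edgeSet} (h : walkPlus p e ≠ 0) :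
    (e : Sym2 V) ∈ p.edges := (mem_edges_iff p e).2 (Or.inl h)

lemma mem_edges_of_walkMinus {a b : V} {p : G.Walk a b} {e : G.edgeSet} (h : walkMinus p e ≠ 0) :
    (e : Sym2 V) ∈ p.edges := (mem_edges_iff p e).2 (Or.inr h)

lemma walkPlus_add_walkMinus_apply [DecidableEq V] {a b : V} (p : G.Walk a b) (e : G.edgeSet) :
    walkPlus p e + walkMinus p e = p.edges.count (e : Sym2 V) := by
  induction p with
  | nil => simp
  | @cons u v w h p ih =>
    simp only [SimpleGraph.Walk.edges_cons, List.count_cons, ← ih, walkPlus_cons, walkMinus_cons,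
      Finsupp.add_apply, edgeExp_apply, beq_iff_eq, @eq_comm _ s(u, v)]
    split_ifs <;> omega

lemma walkPlus_ne_zero {a b : V} {p : G.Walk a b} (h : 0 < p.length) : walkPlus p ≠ 0 := by
  cases p with
  | nil => simp at h
  | cons hadj p =>
    rw [walkPlus_cons]
    intro h0
    exact edgeExp_ne_zero hadj (add_eq_zero.1 h0).1

lemma walkMinus_ne_zero {a b : V} {p : G.Walk a b} (h : 2 ≤ p.length) : walkMinus p ≠ 0 := by
  cases p with
  | nil => simp at h
  | cons hadj p =>
    rw [walkMinus_cons]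
    exact walkPlus_ne_zero (by simp only [SimpleGraph.Walk.length_cons] at h; omega)

lemma degree_walkPlus_add_walkMinus {a b : V} (p : G.Walk a b) :
    (walkPlus p).degree + (walkMinus p).degree = p.length := by
  induction p with
  | nil => simp
  | cons h p ih =>
    simp only [walkPlus_cons, walkMinus_cons, map_add, edgeExp, Finsupp.degree_single,
      SimpleGraph.Walk.length_cons]
    omega

variable [Fintype V] [DecidableEq V] [DecidableRel G.Adj]

/-- The vertex degrees of a monomial in the edge variables. -/
def vdeg (m : G.edgeSet →₀ ℕ) (v : V) : ℕ := ∑ e : G.edgeSet, if v ∈ (e : Sym2 V) then m e else 0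

@[simp] lemma vdeg_zero : vdeg (0 : G.edgeSet →₀ ℕ) = 0 := by
  ext v; simp [vdeg]

@[simp] lemma vdeg_add (m n : G.edgeSet →₀ ℕ) : vdeg (m + n) = vdeg m + vdeg n := by
  ext v
  simp only [vdeg, Pi.add_apply, ← Finset.sum_add_distrib, Finsupp.add_apply]
  exact Finset.sum_congr rfl fun e _ => by split_ifs <;> simp

@[simp] lemma vdeg_edgeExp {a b : V} (h : G.Adj a b) :
    vdeg (edgeExp h) = Pi.single a 1 + Pi.single b 1 := by
  ext v
  have hab := h.ne
  rw [vdeg, Finset.sum_eq_single (⟨s(a, b), h⟩ : G.edgeSet)]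
  · simp only [edgeExp, Finsupp.single_eq_same, Sym2.mem_iff, Pi.add_apply, Pi.single_apply]
    by_cases h1 : v = a
    · subst h1; simp [hab]
    · simp [h1]
  · intro e _ he
    simp [edgeExp, he.symm]
  · simp

lemma vdeg_apply_ne_zero {m : G.edgeSet →₀ ℕ} {v : V} :
    vdeg m v ≠ 0 ↔ ∃ e : G.edgeSet, v ∈ (e : Sym2 V) ∧ m e ≠ 0 := by
  simp [vdeg, Finset.sum_eq_zero_iff]

lemma exists_edge_of_vdeg {m : G.edgeSet →₀ ℕ} {v : V} (h : vdeg m v ≠ 0) :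
    ∃ (u : V) (hu : G.Adj v u), edgeExp hu ≤ m ∧ vdeg m u ≠ 0 := by
  obtain ⟨⟨e, he⟩, hv, hm⟩ := vdeg_apply_ne_zero.1 h
  obtain ⟨u, rfl⟩ := Sym2.mem_iff_exists.1 hv
  refine ⟨u, he, ?_, vdeg_apply_ne_zero.2 ⟨⟨_, he⟩, by simp, hm⟩⟩
  refine Finsupp.single_le_iff.2 ?_
  exact Nat.one_le_iff_ne_zero.2 hm

lemma vdeg_eq_zero {m : G.edgeSet →₀ ℕ} : vdeg m = 0 ↔ m = 0 := by
  refine ⟨fun h => ?_, fun h => by simp [h]⟩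
  ext ⟨e, he⟩
  by_contra hne
  induction e with
  | _ a b =>
    exact vdeg_apply_ne_zero.2 ⟨⟨s(a, b), he⟩, Sym2.mem_mk_left a b, hne⟩ (congrFun h a)

lemma sum_vdeg (m : G.edgeSet →₀ ℕ) : ∑ v, vdeg m v = 2 * m.degree := by
  induction m using Finsupp.induction_linear with
  | zero => simp
  | add f g hf hg => simp [Finset.sum_add_distrib, hf, hg, mul_add]
  | single e n =>
    induction n with
    | zero => simp
    | succ n ih =>
      obtain ⟨e, he⟩ := e
      induction e with
      | _ a b =>
        have he' : G.Adj a b := he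
        have h1 : (Finsupp.single (⟨s(a, b), he⟩ : G.edgeSet) (n + 1)) =
          Finsupp.single ⟨s(a, b), he⟩ n + edgeExp he' := by
          simp [edgeExp, ← Finsupp.single_add]
        rw [h1, vdeg_add, vdeg_edgeExp]
        simp only [Pi.add_apply, Finset.sum_add_distrib, ih]
        simp [edgeExp, Finset.sum_pi_single']
        ring

/-- Handshake identity: a fibre of `vdeg` lies in a single total degree, which makes the ideal
homogeneous for the standard grading. -/
lemma degree_eq_of_vdeg_eq {m n : G.edgeSet →₀ ℕ} (h : vdeg m = vdeg n) : m.degree = n.degree := by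
  have h1 := sum_vdeg m
  rw [h, sum_vdeg] at h1
  omega

/-- Each passage through an interior position uses one edge of each colour, so the two degrees
differ only at the end points; the parity decides the colour of the last edge. The form is additive
to avoid subtraction in `ℕ`. -/
lemma vdeg_walk {a b : V} (p : G.Walk a b) :
    if Even p.length then vdeg (walkPlus p) + Pi.single b 1 = vdeg (walkMinus p) + Pi.single a 1
    else vdeg (walkPlus p) = vdeg (walkMinus p) + (Pi.single a 1 + Pi.single b 1) := by
  induction p with
  | nil => simp
  | @cons x y z h p ih =>
    simp only [SimpleGraph.Walk.length_cons, Nat.even_add_one, walkPlus_cons, walkMinus_cons,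
      vdeg_add, vdeg_edgeExp]
    split_ifs with he
    rotate_left
    · rw [if_neg he] at ih
      rw [ih]; abel
    · rw [if_pos he] at ih
      rw [add_assoc, add_comm (Pi.single y 1), ← ih]
      abel

lemma vdeg_walk_closed {a : V} {p : G.Walk a a} (h : Even p.length) :
    vdeg (walkPlus p) = vdeg (walkMinus p) := by
  have := vdeg_walk p
  rw [if_pos h] at this
  exact add_right_cancel this

lemma vdeg_walk_odd {a b : V} {p : G.Walk a b} (h : ¬ Even p.length) :
    vdeg (walkPlus p) = vdeg (walkMinus p) + (Pi.single a 1 + Pi.single b 1) := by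
  have := vdeg_walk p
  rwa [if_neg h] at this

/-- Every second edge matches up consecutive positions of the walk: all positions when the length is
odd, all but the initial one when it is even and the second colour is taken. -/
lemma vdeg_walk_count {a b : V} (p : G.Walk a b) (v : V) :
    if Even p.length then vdeg (walkMinus p) v = p.support.tail.count v
    else vdeg (walkPlus p) v = p.support.count v := by
  induction p with
  | nil => simp
  | @cons x y z h p ih =>
    simp only [SimpleGraph.Walk.length_cons, Nat.even_add_one, walkPlus_cons, walkMinus_cons,
      vdeg_add, vdeg_edgeExp, SimpleGraph.Walk.support_cons, List.tail_cons]
    split_ifs with he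
    rotate_left
    · rwa [if_neg he] at ih
    · rw [if_pos he] at ih
      rw [← p.cons_tail_support, List.count_cons, List.count_cons, Pi.add_apply, ih]
      simp only [Pi.add_apply, Pi.single_apply, beq_iff_eq, @eq_comm _ v]
      omega

lemma vdeg_closed_count {a : V} {p : G.Walk a a} (h : Even p.length) (v : V) :
    vdeg (walkPlus p) v = p.support.tail.count v := by
  have := vdeg_walk_count p v
  rwa [if_pos h, ← vdeg_walk_closed h] at this

end WalkAlgebra

end ToricGraph

namespace ToricGraph

/-! ### Primitive even closed walks, links and chords -/

section Primitive

variable {V : Type*} {G : SimpleGraph V}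

/-- Two closed walks with the same alternating monomials, up to exchanging the two monomials. -/
def AltEq {a b : V} (w : G.Walk a a) (w' : G.Walk b b) : Prop :=
  (walkPlus w = walkPlus w' ∧ walkMinus w = walkMinus w') ∨
    (walkPlus w = walkMinus w' ∧ walkMinus w = walkPlus w')

lemma AltEq.trans {a b c : V} {w : G.Walk a a} {w' : G.Walk b b} {w'' : G.Walk c c}
    (h : AltEq w w') (h' : AltEq w' w'') : AltEq w w'' := by
  unfold AltEq at *
  rcases h with ⟨h1, h2⟩ | ⟨h1, h2⟩ <;> rw [h1, h2] <;> tauto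

lemma AltEq.length_eq {a b : V} {w : G.Walk a a} {w' : G.Walk b b} (h : AltEq w w') :
    w.length = w'.length := by
  rw [← degree_walkPlus_add_walkMinus, ← degree_walkPlus_add_walkMinus]
  rcases h with ⟨h1, h2⟩ | ⟨h1, h2⟩ <;> rw [h1, h2]
  exact add_comm _ _

lemma AltEq.rotate {a b : V} (p : G.Walk a b) (q : G.Walk b a)
    (h : Even (p.length + q.length)) : AltEq (p.append q) (q.append p) := by
  rw [Nat.even_add] at h
  unfold AltEq
  simp only [walkPlus_append, walkMinus_append]
  by_cases hp : Even p.length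
  · have hq := h.1 hp
    simp [hp, hq, add_comm]
  · have hq : ¬ Even q.length := fun hq => hp (h.2 hq)
    simp [hp, hq, add_comm]

/-- Reversal of an odd walk preserves the parity of positions, so an odd cycle may be traversed in
either direction. -/
lemma AltEq.reverse_left {a : V} (c q : G.Walk a a) (hc : ¬ Even c.length) :
    AltEq (c.append q) (c.reverse.append q) := by
  left
  simp [walkPlus_append, walkMinus_append, walkPlus_reverse, walkMinus_reverse, hc]

/-- An even closed walk whose alternating pair of monomials contains no shorter one. -/
def Primitive {a : V} (w : G.Walk a a) : Prop :=
  Even w.length ∧ 0 < w.length ∧ ∀ (b : V) (w' : G.Walk b b), Even w'.length → 0 < w'.length →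
    ((walkPlus w' ≤ walkPlus w ∧ walkMinus w' ≤ walkMinus w) ∨
      (walkPlus w' ≤ walkMinus w ∧ walkMinus w' ≤ walkPlus w)) → w.length ≤ w'.length

lemma Primitive.altEq {a b : V} {w : G.Walk a a} {w' : G.Walk b b} (hw : Primitive w)
    (h : AltEq w w') : Primitive w' := by
  obtain ⟨h1, h2, h3⟩ := hw
  rw [h.length_eq] at h1 h2
  refine ⟨h1, h2, fun c w'' he hp hle => ?_⟩
  rw [← h.length_eq]
  refine h3 c w'' he hp ?_
  rcases h with ⟨h1, h2⟩ | ⟨h1, h2⟩ <;> rw [h1, h2] <;> tauto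

lemma Primitive.rotate {a b : V} {p : G.Walk a b} {q : G.Walk b a} (h : Primitive (p.append q)) :
    Primitive (q.append p) :=
  h.altEq (AltEq.rotate p q (by simpa using h.1))

/-- An even closed subwalk would be a shorter walk with its alternating pair inside that of the
whole. -/
lemma Primitive.odd_left {a : V} {c q : G.Walk a a} (h : Primitive (c.append q))
    (hc : 0 < c.length) (hq : 0 < q.length) : ¬ Even c.length := by
  intro he
  have := h.2.2 a c he hc (Or.inl ⟨by simp [walkPlus_append], by simp [walkMinus_append]⟩)
  simp only [SimpleGraph.Walk.length_append] at this
  omega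

lemma length_pos_of_ne {a b : V} (p : G.Walk a b) (h : a ≠ b) : 0 < p.length := by
  cases p with
  | nil => exact absurd rfl h
  | cons => simp

/-- All closed subwalks are odd, so `A.length + B.length` and `B.length + C.length` are odd and `A`,
`C` have equal parity. Then `A` followed by the reverse of `C` is a shorter even closed walk whose
alternating pair lies inside the given one. -/
lemma Primitive.not_crossing {x z : V} (hxz : x ≠ z) (A C : G.Walk x z) (B D : G.Walk z x)
    (h : Primitive ((A.append B).append (C.append D))) : False := by
  have lA := length_pos_of_ne A hxz
  have lB := length_pos_of_ne B hxz.symm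
  have lC := length_pos_of_ne C hxz
  have lD := length_pos_of_ne D hxz.symm
  have h1 := h.odd_left (by simp; omega) (by simp; omega)
  have h2 : Primitive ((B.append C).append (D.append A)) := by
    have h' : Primitive (A.append (B.append (C.append D))) := by
      rwa [SimpleGraph.Walk.append_assoc]
    have := h'.rotate
    rwa [SimpleGraph.Walk.append_assoc B C D, ← SimpleGraph.Walk.append_assoc (B.append C)] at this
  have h3 := h2.odd_left (by simp; omega) (by simp; omega)
  have h0 := h.1
  simp only [SimpleGraph.Walk.length_append, Nat.even_add] at h0 h1 h3
  have hlen := h.2.2 x (A.append C.reverse)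
    (by simp only [SimpleGraph.Walk.length_append, SimpleGraph.Walk.length_reverse, Nat.even_add]
        tauto)
    (by simp; omega)
  simp only [SimpleGraph.Walk.length_append, SimpleGraph.Walk.length_reverse] at hlen
  have : A.length + B.length + (C.length + D.length) ≤ A.length + C.length := by
    refine hlen (Or.inl ?_)
    by_cases hA : Even A.length
    · have hB : ¬ Even B.length := by tauto
      have hC : Even C.length := by tauto
      simp only [walkPlus_append, walkMinus_append, walkPlus_reverse, walkMinus_reverse, hA, hB, hC,
        SimpleGraph.Walk.length_append, Nat.even_add, if_true, if_false, iff_false, not_true]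
      exact ⟨le_iff_exists_add.2 ⟨walkPlus B + walkMinus D, by abel⟩,
        le_iff_exists_add.2 ⟨walkMinus B + walkPlus D, by abel⟩⟩
    · have hB : Even B.length := by tauto
      have hC : ¬ Even C.length := by tauto
      simp only [walkPlus_append, walkMinus_append, walkPlus_reverse, walkMinus_reverse, hA, hB, hC,
        SimpleGraph.Walk.length_append, Nat.even_add, if_false, iff_true]
      exact ⟨le_iff_exists_add.2 ⟨walkMinus B + walkPlus D, by abel⟩,
        le_iff_exists_add.2 ⟨walkPlus B + walkMinus D, by abel⟩⟩
  omega

/-- The closed walk `c ++ q` decomposes at a vertex common to both parts. -/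
lemma Primitive.inter_eq {x z : V} {c q : G.Walk x x} (h : Primitive (c.append q))
    (hc : z ∈ c.support) (hq : z ∈ q.support) : z = x := by
  by_contra hne
  obtain ⟨A, B, rfl⟩ := SimpleGraph.Walk.mem_support_iff_exists_append.1 hc
  obtain ⟨C, D, rfl⟩ := SimpleGraph.Walk.mem_support_iff_exists_append.1 hq
  exact h.not_crossing (Ne.symm hne) A C B D

variable [Fintype V] [DecidableEq V] [DecidableRel G.Adj]

/-- Grow a walk that uses variables of `R` and `B` alternately. As long as it is not both even and
closed, one colour has been used less than the other at its end point, and equality of vertex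
degrees leaves an unused edge of that colour there. The number of unused variables decreases. -/
lemma exists_alternating {R B : G.edgeSet →₀ ℕ} (hD : vdeg R = vdeg B) (hR : R ≠ 0) :
    ∃ (a : V) (w : G.Walk a a), Even w.length ∧ 0 < w.length ∧ walkPlus w ≤ R ∧ walkMinus w ≤ B := by
  have main : ∀ (n : ℕ) (a b : V) (w : G.Walk a b), 0 < w.length → walkPlus w ≤ R →
      walkMinus w ≤ B → R.degree + B.degree - w.length = n →
      ∃ (a : V) (w : G.Walk a a), Even w.length ∧ 0 < w.length ∧
        walkPlus w ≤ R ∧ walkMinus w ≤ B := by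
    intro n
    induction n using Nat.strong_induction_on with
    | _ n ih =>
      intro a b w hl hP hM hn
      obtain ⟨R', hR'⟩ := le_iff_exists_add.1 hP
      obtain ⟨B', hB'⟩ := le_iff_exists_add.1 hM
      have hw := vdeg_walk w
      have hDb := congrFun hD b
      rw [hR', hB'] at hDb
      have hext : ∀ (c : V) (h : G.Adj b c), (if Even w.length then edgeExp h ≤ R'
          else edgeExp h ≤ B') → ∃ (a : V) (w : G.Walk a a), Even w.length ∧ 0 < w.length ∧
            walkPlus w ≤ R ∧ walkMinus w ≤ B := by
        intro c h hle
        have hP' : walkPlus (w.concat h) ≤ R := by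
          rw [SimpleGraph.Walk.concat_eq_append, walkPlus_append, hR', walkPlus_cons,
            walkMinus_cons]
          split_ifs at hle ⊢
          · simpa using hle
          · simp
        have hM' : walkMinus (w.concat h) ≤ B := by
          rw [SimpleGraph.Walk.concat_eq_append, walkMinus_append, hB', walkPlus_cons,
            walkMinus_cons]
          split_ifs at hle ⊢
          · simp
          · simpa using hle
        have hlen := degree_walkPlus_add_walkMinus (w.concat h)
        obtain ⟨R'', hR''⟩ := le_iff_exists_add.1 hP'
        obtain ⟨B'', hB''⟩ := le_iff_exists_add.1 hM'
        have e1 := congrArg Finsupp.degree hR''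
        have e2 := congrArg Finsupp.degree hB''
        simp only [map_add] at e1 e2
        rw [SimpleGraph.Walk.length_concat] at hlen
        exact ih (R.degree + B.degree - (w.length + 1)) (by omega) a c (w.concat h) (by simp) hP' hM'
          (by rw [SimpleGraph.Walk.length_concat])
      by_cases he : Even w.length
      · by_cases hab : a = b
        · subst hab; exact ⟨a, w, he, hl, hP, hM⟩
        · rw [if_pos he] at hw
          have hwb := congrFun hw b
          simp only [vdeg_add, Pi.add_apply, Pi.single_eq_same, ne_eq, Ne.symm hab,
            not_false_eq_true, Pi.single_eq_of_ne] at hwb hDb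
          obtain ⟨c, hc, hle, -⟩ := exists_edge_of_vdeg (m := R') (v := b) (by omega)
          exact hext c hc (by rwa [if_pos he])
      · rw [if_neg he] at hw
        have hwb := congrFun hw b
        simp only [vdeg_add, Pi.add_apply, Pi.single_eq_same] at hwb hDb
        obtain ⟨c, hc, hle, -⟩ := exists_edge_of_vdeg (m := B') (v := b) (by omega)
        exact hext c hc (by rwa [if_neg he])
  have hv : vdeg R ≠ 0 := fun h => hR (vdeg_eq_zero.1 h)
  obtain ⟨v, hv⟩ := Function.ne_iff.1 hv
  obtain ⟨c, hc, hle, -⟩ := exists_edge_of_vdeg hv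
  exact main _ v c (SimpleGraph.Walk.cons hc .nil) (by simp)
    (by rw [walkPlus_cons]; simpa using hle) (by rw [walkMinus_cons]; simp) rfl

/-- Monomials of the same degree connected by steps that keep a common variable. -/
def Linked (m n : G.edgeSet →₀ ℕ) : Prop :=
  Relation.ReflTransGen (fun m n => vdeg m = vdeg n ∧ ∃ e, m e ≠ 0 ∧ n e ≠ 0) m n

lemma Linked.symm {m n : G.edgeSet →₀ ℕ} (h : Linked m n) : Linked n m := by
  induction h with
  | refl => exact Relation.ReflTransGen.refl
  | tail _ hbc ih =>
    exact Relation.ReflTransGen.head ⟨hbc.1.symm, hbc.2.imp fun _ h => ⟨h.2, h.1⟩⟩ ih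

lemma Linked.trans {m n k : G.edgeSet →₀ ℕ} (h : Linked m n) (h' : Linked n k) : Linked m k :=
  Relation.ReflTransGen.trans h h'

lemma Linked.of_common {m n : G.edgeSet →₀ ℕ} (h : vdeg m = vdeg n) {e : G.edgeSet}
    (hm : m e ≠ 0) (hn : n e ≠ 0) : Linked m n :=
  Relation.ReflTransGen.single ⟨h, e, hm, hn⟩

lemma Linked.of_le {m n k : G.edgeSet →₀ ℕ} (h : vdeg m = vdeg n) (hk : k ≠ 0)
    (hm : k ≤ m) (hn : k ≤ n) : Linked m n := by
  obtain ⟨e, he⟩ := Finsupp.ne_iff.1 hk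
  have h1 := hm e
  have h2 := hn e
  simp only [Finsupp.coe_zero, Pi.zero_apply] at he
  exact Linked.of_common h (e := e) (by omega) (by omega)

/-- A pair of monomials of the same degree split into two smaller pairs of the same degree. -/
def PairSplit (R B : G.edgeSet →₀ ℕ) : Prop :=
  ∃ R₁ R₂ B₁ B₂, R = R₁ + R₂ ∧ B = B₁ + B₂ ∧ vdeg R₁ = vdeg B₁ ∧
    R₁ ≠ 0 ∧ R₂ ≠ 0 ∧ B₁ ≠ 0 ∧ B₂ ≠ 0

/-- A pair of monomials of the same degree split into two smaller pairs by an edge. -/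
def ChordSplit (R B : G.edgeSet →₀ ℕ) : Prop :=
  ∃ (z u : V) (h : G.Adj z u) (R₁ R₂ B₁ B₂ : G.edgeSet →₀ ℕ), R = R₁ + R₂ ∧ B = B₁ + B₂ ∧
    vdeg R₁ = vdeg (B₁ + edgeExp h) ∧ vdeg (R₂ + edgeExp h) = vdeg B₂ ∧ R₂ ≠ 0 ∧ B₁ ≠ 0 ∧
    (¬ R₂.support ⊆ R₁.support ∨ ¬ B₁.support ⊆ B₂.support)

lemma ChordSplit.symm {R B : G.edgeSet →₀ ℕ} (h : ChordSplit R B) : ChordSplit B R := by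
  obtain ⟨z, u, h, R₁, R₂, B₁, B₂, hR, hB, h1, h2, h3, h4, h5⟩ := h
  exact ⟨z, u, h, B₂, B₁, R₂, R₁, by rw [hB, add_comm], by rw [hR, add_comm], h2.symm, h1.symm,
    h4, h3, h5.symm⟩

/-- The monomial `B₁ + R₂` shares `R₂` with `R` and `B₁` with `B`. -/
lemma PairSplit.linked {R B : G.edgeSet →₀ ℕ} (hD : vdeg R = vdeg B) (h : PairSplit R B) :
    Linked R B := by
  obtain ⟨R₁, R₂, B₁, B₂, rfl, rfl, h1, h2, h3, h4, h5⟩ := h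
  refine (Linked.of_le (n := B₁ + R₂) ?_ h3 ?_ ?_).trans (Linked.of_le ?_ h4 ?_ ?_)
  · simp [h1]
  · simp
  · simp
  · rw [← hD]; simp [h1]
  · simp
  · simp

/-- The path in the fibre goes through `B₁ + edgeExp h + R₂`. -/
lemma linked_of_edge {R₁ R₂ B₁ B₂ : G.edgeSet →₀ ℕ} {z u : V} (h : G.Adj z u)
    (h1 : vdeg R₁ = vdeg (B₁ + edgeExp h)) (h2 : vdeg (R₂ + edgeExp h) = vdeg B₂)
    (hR : R₂ ≠ 0) (hB : B₁ ≠ 0) : Linked (R₁ + R₂) (B₁ + B₂) := by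
  refine (Linked.of_le (n := B₁ + edgeExp h + R₂) ?_ hR ?_ ?_).trans (Linked.of_le ?_ hB ?_ ?_)
  · rw [vdeg_add, h1, vdeg_add _ R₂]
  · simp
  · simp
  · rw [vdeg_add B₁ B₂, ← h2]; simp [add_comm, add_left_comm]
  · rw [add_assoc]; simp
  · simp

lemma ChordSplit.linked {R B : G.edgeSet →₀ ℕ} (h : ChordSplit R B) : Linked R B := by
  obtain ⟨z, u, h, R₁, R₂, B₁, B₂, rfl, rfl, h1, h2, h3, h4, -⟩ := h
  exact linked_of_edge h h1 h2 h3 h4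

lemma vdeg_odd_chord {z u : V} {s : G.Walk z u} (hs : ¬ Even s.length) (h : G.Adj z u) :
    vdeg (walkPlus s) = vdeg (walkMinus s + edgeExp h) := by
  rw [vdeg_add, vdeg_edgeExp]; exact vdeg_walk_odd hs

lemma vdeg_odd_chord' {z u : V} {s : G.Walk z u} (hs : ¬ Even s.length) (h : G.Adj u z) :
    vdeg (walkMinus s + edgeExp h) = vdeg (walkPlus s) := by
  rw [vdeg_add, vdeg_edgeExp, add_comm (Pi.single u 1)]; exact (vdeg_walk_odd hs).symm

lemma linked_of_odd_chord {z u : V} (s : G.Walk z u) (t : G.Walk u z) (hs : ¬ Even s.length)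
    (ht : ¬ Even t.length) (hs2 : 2 ≤ s.length) (ht2 : 2 ≤ t.length) (h : G.Adj z u) :
    Linked (walkPlus (s.append t)) (walkMinus (s.append t)) := by
  simp only [walkPlus_append, walkMinus_append, hs, if_false]
  exact linked_of_edge h (vdeg_odd_chord hs h) (vdeg_odd_chord' ht h) (walkMinus_ne_zero ht2)
    (walkMinus_ne_zero hs2)

/-- An edge from an odd cycle to the rest of an even closed walk, at odd distance. -/
lemma chordSplit_of_odd {x z u : V} (hz : z ≠ x) (hu : u ≠ x) (a₁ : G.Walk x z) (a₂ : G.Walk z x)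
    (q₁ : G.Walk x u) (q₂ : G.Walk u x) (hc : ¬ Even (a₁.append a₂).length)
    (hq : ¬ Even (q₁.append q₂).length) (hs : ¬ Even (a₂.append q₁).length)
    (hnd : (a₁.append a₂).edges.Nodup)
    (hdis : ∀ e ∈ (a₁.append a₂).edges, e ∉ (q₁.append q₂).edges) (h : G.Adj z u) :
    ChordSplit (walkPlus ((a₁.append a₂).append (q₁.append q₂)))
      (walkMinus ((a₁.append a₂).append (q₁.append q₂))) := by
  have l1 := length_pos_of_ne a₁ hz.symm
  have l2 := length_pos_of_ne a₂ hz
  have l3 := length_pos_of_ne q₁ hu.symm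
  have l4 := length_pos_of_ne q₂ hu
  have ht : ¬ Even (q₂.append a₁).length := by
    simp only [SimpleGraph.Walk.length_append, Nat.even_add] at hc hq hs ⊢; tauto
  have hPs := vdeg_odd_chord hs h
  have hPt := vdeg_odd_chord ht h.symm
  have hs2 : walkMinus (a₂.append q₁) ≠ 0 := walkMinus_ne_zero (by simp; omega)
  have ht2 : walkMinus (q₂.append a₁) ≠ 0 := walkMinus_ne_zero (by simp; omega)
  rw [edgeExp_symm h] at hPt
  rw [SimpleGraph.Walk.edges_append, List.nodup_append] at hnd
  simp only [SimpleGraph.Walk.length_append, Nat.even_add] at hc hq hs ht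
  have he1 : ∀ e : G.edgeSet, (e : Sym2 V) ∈ a₁.edges → walkPlus (a₂.append q₁) e = 0 := by
    intro e he
    by_contra hne
    have := mem_edges_of_walkPlus hne
    rw [SimpleGraph.Walk.edges_append, List.mem_append] at this
    rcases this with h' | h'
    · exact hnd.2.2 _ he _ h' rfl
    · exact hdis e (by simp [he]) (by simp [h'])
  have he2 : ∀ e : G.edgeSet, (e : Sym2 V) ∈ a₂.edges → walkPlus (q₂.append a₁) e = 0 := by
    intro e he
    by_contra hne
    have := mem_edges_of_walkPlus hne
    rw [SimpleGraph.Walk.edges_append, List.mem_append] at this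
    rcases this with h' | h'
    · exact hdis e (by simp [he]) (by simp [h'])
    · exact hnd.2.2 _ h' _ he rfl
  -- The chord cuts the closed walk into the odd walks `a₂ q₁` and `q₂ a₁`; the parity of `a₁`
  -- decides to which monomial each colour belongs. Variables of one arc of the cycle, absent from
  -- the `walkPlus` of the walk along the other arc, witness the non-inclusion of supports.
  by_cases h1 : Even a₁.length
  · have h2 : ¬ Even a₂.length := fun h2 => hc (iff_of_true h1 h2)
    have h3 : Even q₁.length := by_contra fun h3 => hs (iff_of_false h2 h3)
    have h4 : ¬ Even q₂.length := fun h4 => hq (iff_of_true h3 h4)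
    refine ⟨z, u, h, walkPlus (a₂.append q₁), walkMinus (q₂.append a₁), walkMinus (a₂.append q₁),
      walkPlus (q₂.append a₁), ?_, ?_, hPs, hPt.symm, ht2, hs2, Or.inl ?_⟩
    · simp only [walkPlus_append, walkMinus_append, SimpleGraph.Walk.length_append, Nat.even_add,
        h1, h2, h3, h4, if_true, if_false, iff_false, not_true]
      abel
    · simp only [walkPlus_append, walkMinus_append, SimpleGraph.Walk.length_append, Nat.even_add,
        h1, h2, h3, h4, if_true, if_false, iff_false, not_true]
      abel
    · intro hsub
      obtain ⟨e, he⟩ := Finsupp.ne_iff.1 (walkPlus_ne_zero l1)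
      have h5 : e ∈ (walkMinus (q₂.append a₁)).support := by
        simp only [walkMinus_append, h4, if_false, Finsupp.mem_support_iff, Finsupp.add_apply]
        simp only [Finsupp.coe_zero, Pi.zero_apply] at he
        omega
      exact (Finsupp.mem_support_iff.1 (hsub h5)) (he1 e (mem_edges_of_walkPlus he))
  · have h2 : Even a₂.length := by_contra fun h2 => hc (iff_of_false h1 h2)
    have h3 : ¬ Even q₁.length := fun h3 => hs (iff_of_true h2 h3)
    have h4 : Even q₂.length := by_contra fun h4 => hq (iff_of_false h3 h4)
    refine ⟨z, u, h, walkPlus (q₂.append a₁), walkMinus (a₂.append q₁), walkMinus (q₂.append a₁),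
      walkPlus (a₂.append q₁), ?_, ?_, hPt, hPs.symm, hs2, ht2, Or.inl ?_⟩
    · simp only [walkPlus_append, walkMinus_append, SimpleGraph.Walk.length_append, Nat.even_add,
        h1, h2, h3, h4, if_true, if_false, iff_true]
      abel
    · simp only [walkPlus_append, walkMinus_append, SimpleGraph.Walk.length_append, Nat.even_add,
        h1, h2, h3, h4, if_true, if_false, iff_true]
      abel
    · intro hsub
      have l2' : 2 ≤ a₂.length := by
        rcases h2 with ⟨k, hk⟩; omega
      obtain ⟨e, he⟩ := Finsupp.ne_iff.1 (walkMinus_ne_zero l2')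
      have h5 : e ∈ (walkMinus (a₂.append q₁)).support := by
        simp only [walkMinus_append, h2, if_true, Finsupp.mem_support_iff, Finsupp.add_apply]
        simp only [Finsupp.coe_zero, Pi.zero_apply] at he
        omega
      exact (Finsupp.mem_support_iff.1 (hsub h5)) (he2 e (mem_edges_of_walkMinus he))

/-- An edge from an odd cycle to the rest of a primitive even closed walk. -/
lemma Primitive.chordSplit {x z u : V} {c q : G.Walk x x} (hw : Primitive (c.append q))
    (hc : c.IsCycle) (hq0 : 0 < q.length) (hzc : z ∈ c.support) (huq : u ∈ q.support)
    (hz : z ≠ x) (hu : u ≠ x) (h : G.Adj z u) :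
    ChordSplit (walkPlus (c.append q)) (walkMinus (c.append q)) := by
  have hco := hw.odd_left (by have := hc.three_le_length; omega) hq0
  have hqo : ¬ Even q.length := by
    have := hw.1
    simp only [SimpleGraph.Walk.length_append, Nat.even_add] at this
    tauto
  have hdis : ∀ e ∈ c.edges, e ∉ q.edges := by
    intro e
    induction e with
    | _ s t =>
      intro hec heq
      have h1 := hw.inter_eq (c.fst_mem_support_of_mem_edges hec)
        (q.fst_mem_support_of_mem_edges heq)
      have h2 := hw.inter_eq (c.snd_mem_support_of_mem_edges hec)
        (q.snd_mem_support_of_mem_edges heq)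
      exact (c.adj_of_mem_edges hec).ne (h1.trans h2.symm)
  have hnd := hc.edges_nodup
  obtain ⟨a₁, a₂, rfl⟩ := SimpleGraph.Walk.mem_support_iff_exists_append.1 hzc
  obtain ⟨q₁, q₂, rfl⟩ := SimpleGraph.Walk.mem_support_iff_exists_append.1 huq
  -- If this walk is even, traverse the odd cycle backwards: the arc `a₂` is replaced by the other
  -- arc, of opposite parity, and the pair of monomials does not change.
  by_cases hs : Even (a₂.append q₁).length
  · have key := chordSplit_of_odd hz hu a₂.reverse a₁.reverse q₁ q₂
      (by rwa [← SimpleGraph.Walk.reverse_append, SimpleGraph.Walk.length_reverse]) hqo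
      (by simp only [SimpleGraph.Walk.length_append, SimpleGraph.Walk.length_reverse,
            Nat.even_add] at hs hco ⊢
          tauto)
      (by rwa [← SimpleGraph.Walk.reverse_append, SimpleGraph.Walk.edges_reverse,
            List.nodup_reverse])
      (by rw [← SimpleGraph.Walk.reverse_append, SimpleGraph.Walk.edges_reverse]
          simpa only [List.mem_reverse] using hdis) h
    rw [← SimpleGraph.Walk.reverse_append] at key
    rcases AltEq.reverse_left (a₁.append a₂) (q₁.append q₂) hco with h' | h'
    · rwa [h'.1, h'.2]
    · rw [h'.1, h'.2]; exact key.symm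
  · exact chordSplit_of_odd hz hu a₁ a₂ q₁ q₂ hco hqo hs hnd hdis h

end Primitive

end ToricGraph

namespace ToricGraph

/-! ### Induced subgraphs from shortest odd closed walks -/

section Induced

variable {V : Type*} {G : SimpleGraph V}

lemma exists_closed_subwalk {a b : V} (w : G.Walk a b) (h : ¬ w.support.Nodup) :
    ∃ (x : V) (p : G.Walk a x) (c : G.Walk x x) (q : G.Walk x b),
      w = p.append (c.append q) ∧ 0 < c.length ∧ c.support.tail.Nodup := by
  classical
  induction w with
  | nil => simp at h
  | @cons a v b hadj p ih =>
    by_cases hp : p.support.Nodup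
    · have ha : a ∈ p.support := by
        by_contra ha
        exact h (by simpa using ⟨ha, hp⟩)
      obtain ⟨p₁, p₂, rfl⟩ := SimpleGraph.Walk.mem_support_iff_exists_append.1 ha
      refine ⟨a, .nil, .cons hadj p₁, p₂, by simp, by simp, ?_⟩
      rw [SimpleGraph.Walk.support_append] at hp
      simpa using (List.nodup_append.1 hp).1
    · obtain ⟨x, p', c, q, rfl, h1, h2⟩ := ih hp
      exact ⟨x, .cons hadj p', c, q, by simp, h1, h2⟩

lemma isCycle_of_nodup {a : V} {w : G.Walk a a} (h : w.support.tail.Nodup) (hl : 3 ≤ w.length) :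
    w.IsCycle := by
  rw [SimpleGraph.Walk.isCycle_iff_isPath_tail_and_le_length]
  refine ⟨?_, hl⟩
  cases w with
  | nil => simp at hl
  | cons hadj p => simpa [SimpleGraph.Walk.isPath_def] using h

lemma edge_mem_of_length_one {s t : V} (m : G.Walk s t) (h : m.length = 1) : s(s, t) ∈ m.edges := by
  cases m with
  | nil => simp at h
  | cons hadj p =>
    cases p with
    | nil => simp
    | cons => simp at h

/-- Loops and shortcuts would shorten the walk without leaving its vertex set, so comparison with
walks on these vertices suffices. -/
lemma isPath_and_mem_edges_of_shortest {a b : V} {p : G.Walk a b}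
    (hp : ∀ q : G.Walk a b, (∀ z ∈ q.support, z ∈ p.support) → p.length ≤ q.length) :
    p.IsPath ∧ ∀ s ∈ p.support, ∀ t ∈ p.support, G.Adj s t → s(s, t) ∈ p.edges := by
  constructor
  · rw [SimpleGraph.Walk.isPath_def]
    by_contra h
    obtain ⟨x, p', c, q, rfl, h1, -⟩ := exists_closed_subwalk p h
    have := hp (p'.append q) (by
      simp only [SimpleGraph.Walk.mem_support_append_iff]; tauto)
    simp only [SimpleGraph.Walk.length_append] at this
    omega
  · intro s hs t ht hst
    obtain ⟨p₁, p₂, rfl⟩ := SimpleGraph.Walk.mem_support_iff_exists_append.1 hs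
    rw [SimpleGraph.Walk.mem_support_append_iff] at ht
    rcases ht with ht | ht
    · obtain ⟨p₀, m, rfl⟩ := SimpleGraph.Walk.mem_support_iff_exists_append.1 ht
      have := hp (p₀.append (.cons hst.symm p₂)) (by
        simp only [SimpleGraph.Walk.mem_support_append_iff, SimpleGraph.Walk.support_cons,
          List.mem_cons]
        rintro z (h | rfl | h) <;> simp [*])
      simp only [SimpleGraph.Walk.length_append, SimpleGraph.Walk.length_cons] at this
      have hm : m.length = 1 := by
        have := length_pos_of_ne m hst.ne.symm
        omega
      have := edge_mem_of_length_one m hm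
      rw [Sym2.eq_swap] at this
      simp [this]
    · obtain ⟨m, r, rfl⟩ := SimpleGraph.Walk.mem_support_iff_exists_append.1 ht
      have := hp (p₁.append (.cons hst r)) (by
        simp only [SimpleGraph.Walk.mem_support_append_iff, SimpleGraph.Walk.support_cons,
          List.mem_cons]
        rintro z (h | rfl | h) <;> simp [*])
      simp only [SimpleGraph.Walk.length_append, SimpleGraph.Walk.length_cons] at this
      have hm : m.length = 1 := by
        have := length_pos_of_ne m hst.ne
        omega
      have := edge_mem_of_length_one m hm
      simp [this]

lemma exists_split {a s t : V} (k : G.Walk a a) (hs : s ∈ k.support) (ht : t ∈ k.support) :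
    ∃ (m₁ : G.Walk s t) (m₂ : G.Walk t s), m₁.length + m₂.length = k.length ∧
      (∀ z, (z ∈ m₁.support ∨ z ∈ m₂.support) ↔ z ∈ k.support) ∧
      (∀ e, (e ∈ m₁.edges ∨ e ∈ m₂.edges) ↔ e ∈ k.edges) := by
  classical
  have ht' : t ∈ (k.rotate s hs).support := (k.mem_support_rotate_iff s hs).2 ht
  obtain ⟨m₁, m₂, h⟩ := SimpleGraph.Walk.mem_support_iff_exists_append.1 ht'
  refine ⟨m₁, m₂, ?_, fun z => ?_, fun e => ?_⟩
  · rw [← k.length_rotate s hs, h, SimpleGraph.Walk.length_append]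
  · rw [← k.mem_support_rotate_iff s hs, h, SimpleGraph.Walk.mem_support_append_iff]
  · rw [← (k.rotate_edges s hs).perm.mem_iff, h, SimpleGraph.Walk.edges_append, List.mem_append]

/-- A repeated vertex cuts an odd closed walk into two closed walks, one of them odd and shorter. A
chord closes the even one of the two arcs to an odd closed walk, and minimality forces the other arc
to be a single edge. -/
lemma isCycle_and_mem_edges_of_shortest_odd {a : V} {k : G.Walk a a} (hk : Odd k.length)
    (hmin : ∀ (a' : V) (k' : G.Walk a' a'), Odd k'.length → (∀ z ∈ k'.support, z ∈ k.support) →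
      k.length ≤ k'.length) :
    k.IsCycle ∧ ∀ s ∈ k.support, ∀ t ∈ k.support, G.Adj s t → s(s, t) ∈ k.edges := by
  constructor
  · cases k with
    | nil => simp at hk
    | @cons _ v _ hadj p =>
      refine isCycle_of_nodup ?_ ?_
      · rw [SimpleGraph.Walk.support_cons, List.tail_cons]
        by_contra h
        obtain ⟨x, p', c, q, rfl, h1, -⟩ := exists_closed_subwalk p h
        by_cases hc : Odd c.length
        · have := hmin _ c hc (by
            intro z hz
            simp [SimpleGraph.Walk.mem_support_append_iff, hz])
          simp only [SimpleGraph.Walk.length_cons, SimpleGraph.Walk.length_append] at this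
          omega
        · have := hmin _ (.cons hadj (p'.append q)) (by
            rw [Nat.not_odd_iff_even] at hc
            obtain ⟨i, hi⟩ := hk
            obtain ⟨j, hj⟩ := hc
            simp only [SimpleGraph.Walk.length_cons, SimpleGraph.Walk.length_append] at hi ⊢
            exact ⟨i - j, by omega⟩) (by
            simp only [SimpleGraph.Walk.support_cons, SimpleGraph.Walk.mem_support_append_iff,
              List.mem_cons]
            tauto)
          simp only [SimpleGraph.Walk.length_cons, SimpleGraph.Walk.length_append] at this
          omega
      · have hp := length_pos_of_ne p hadj.ne.symm
        simp only [SimpleGraph.Walk.length_cons] at hk ⊢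
        obtain ⟨m, hm⟩ := hk
        omega
  · intro s hs t ht hst
    obtain ⟨m₁, m₂, hl, hsup, hed⟩ := exists_split k hs ht
    have l1 := length_pos_of_ne m₁ hst.ne
    have l2 := length_pos_of_ne m₂ hst.ne.symm
    by_cases he : Even m₁.length
    · have := hmin _ (m₁.concat hst.symm) (by
        rw [SimpleGraph.Walk.length_concat]; exact he.add_one) (by
        intro z
        simp only [SimpleGraph.Walk.support_concat, List.mem_append, List.mem_singleton]
        rintro (h | rfl)
        · exact (hsup z).1 (Or.inl h)
        · exact hs)
      rw [SimpleGraph.Walk.length_concat] at this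
      have := edge_mem_of_length_one m₂ (by omega)
      rw [Sym2.eq_swap] at this
      exact (hed _).1 (Or.inr this)
    · have := hmin _ (m₂.concat hst) (by
        rw [SimpleGraph.Walk.length_concat]
        rw [← hl, Nat.odd_add] at hk
        exact (hk.1 (Nat.not_even_iff_odd.1 he)).add_one) (by
        intro z
        simp only [SimpleGraph.Walk.support_concat, List.mem_append, List.mem_singleton]
        rintro (h | rfl)
        · exact (hsup z).1 (Or.inr h)
        · exact ht)
      rw [SimpleGraph.Walk.length_concat] at this
      have := edge_mem_of_length_one m₁ (by omega)
      exact (hed _).1 (Or.inl this)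

lemma exists_closed_at {a s : V} (k : G.Walk a a) (hs : s ∈ k.support) :
    ∃ k' : G.Walk s s, k'.length = k.length ∧ ∀ z, z ∈ k'.support ↔ z ∈ k.support := by
  classical
  exact ⟨k.rotate s hs, k.length_rotate s hs, fun z => k.mem_support_rotate_iff s hs⟩

/-- A shortest walk that leaves a shortest odd closed walk inside `A` has no superfluous edges to
this closed walk, if only one vertex of `A` has neighbours outside. -/
lemma shortest_from_odd {U A : Set V} {x a b : V} {k : G.Walk a a} {p : G.Walk a b}
    (hAU : A ⊆ U) (hA : ∀ z ∈ A, z ≠ x → ∀ u ∈ U, u ∉ A → ¬ G.Adj z u)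
    (hk : Odd k.length) (hkA : ∀ z ∈ k.support, z ∈ A) (hpU : ∀ z ∈ p.support, z ∈ U)
    (hmin : ∀ (a' : V) (k' : G.Walk a' a'), Odd k'.length → (∀ z ∈ k'.support, z ∈ A) →
      k.length ≤ k'.length)
    (hminp : ∀ (a' : V) (k' : G.Walk a' a') (q : G.Walk a' b), k'.length = k.length →
      (∀ z ∈ k'.support, z ∈ A) → (∀ z ∈ q.support, z ∈ U) → p.length ≤ q.length) :
    (∀ z ∈ p.support, z ∈ k.support → z = a) ∧
    ∀ s ∈ p.support, ∀ t ∈ k.support, s ∉ k.support → G.Adj s t → s(s, t) ∈ p.edges := by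
  constructor
  · intro z hz hzk
    obtain ⟨k', hk', hs'⟩ := exists_closed_at k hzk
    obtain ⟨p₁, p₂, rfl⟩ := SimpleGraph.Walk.mem_support_iff_exists_append.1 hz
    have := hminp z k' p₂ hk' (fun y hy => hkA y ((hs' y).1 hy))
      (fun y hy => hpU y (SimpleGraph.Walk.mem_support_append_iff _ _ |>.2 (Or.inr hy)))
    rw [SimpleGraph.Walk.length_append] at this
    exact (SimpleGraph.Walk.eq_of_length_eq_zero (p := p₁) (by omega)).symm
  · intro s hs t ht hsk hst
    have hak : a ∈ k.support := k.start_mem_support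
    obtain ⟨p₁, p₂, rfl⟩ := SimpleGraph.Walk.mem_support_iff_exists_append.1 hs
    have hp₂ : ∀ y ∈ p₂.support, y ∈ U := fun y hy =>
      hpU y (SimpleGraph.Walk.mem_support_append_iff _ _ |>.2 (Or.inr hy))
    have hsU : s ∈ U := hpU s hs
    -- Otherwise a rotation of `k` to start at `t`, followed by a step to `s`, would shorten the
    -- walk.
    have l1 : p₁.length = 1 := by
      obtain ⟨k', hk', hs'⟩ := exists_closed_at k ht
      have := hminp t k' (.cons hst.symm p₂) hk' (fun y hy => hkA y ((hs' y).1 hy)) (by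
        simp only [SimpleGraph.Walk.support_cons, List.mem_cons]
        rintro y (rfl | hy)
        · exact hAU (hkA _ ht)
        · exact hp₂ y hy)
      simp only [SimpleGraph.Walk.length_append, SimpleGraph.Walk.length_cons] at this
      have := length_pos_of_ne p₁ (by rintro rfl; exact hsk hak)
      omega
    have has : G.Adj a s := SimpleGraph.Walk.adj_of_length_eq_one l1
    by_cases hta : t = a
    · subst hta
      have := edge_mem_of_length_one p₁ l1
      rw [Sym2.eq_swap] at this
      simp [this]
    exfalso
    -- If `s` were outside `A`, its neighbours `a` and `t` in `A` would both be `x`.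
    have hsA : s ∈ A := by
      by_contra hsA
      have h1 : a = x := by
        by_contra h
        exact hA a (hkA a hak) h s hsU hsA has
      have h2 : t = x := by
        by_contra h
        exact hA t (hkA t ht) h s hsU hsA hst.symm
      exact hta (h2.trans h1.symm)
    have key : ∀ k' : G.Walk s s, Odd k'.length → (∀ z ∈ k'.support, z ∈ A) →
        k'.length ≤ k.length → False := by
      intro k' ho hs' hl
      have := hminp s k' p₂ (le_antisymm hl (hmin s k' ho hs')) hs' hp₂
      rw [SimpleGraph.Walk.length_append] at this
      omega
    -- Replacing the even arc of `k` between `a` and `t` by the detour through `s` gives an odd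
    -- closed walk, not longer than `k`, that can be based at `s`; from there the shorter walk `p₂`
    -- reaches `b`.
    obtain ⟨m₁, m₂, hl, hsup, -⟩ := exists_split k hak ht
    have lm1 := length_pos_of_ne m₁ (Ne.symm hta)
    have lm2 := length_pos_of_ne m₂ hta
    rw [← hl] at hk
    by_cases he : Even m₁.length
    · refine key (.cons hst (m₂.concat has)) ?_ ?_ ?_
      · have : Odd m₂.length := by
          rcases hk with ⟨i, hi⟩; rcases he with ⟨j, hj⟩; exact ⟨i - j, by omega⟩
        simp only [SimpleGraph.Walk.length_cons, SimpleGraph.Walk.length_concat]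
        exact this.add_one.add_one
      · simp only [SimpleGraph.Walk.support_cons, SimpleGraph.Walk.support_concat, List.mem_cons,
          List.mem_append, List.not_mem_nil, or_false]
        rintro z (rfl | h | rfl)
        · exact hsA
        · exact hkA z ((hsup z).1 (Or.inr h))
        · exact hsA
      · simp only [SimpleGraph.Walk.length_cons, SimpleGraph.Walk.length_concat]
        rcases he with ⟨i, hi⟩; omega
    · refine key (.cons has.symm (m₁.concat hst.symm)) ?_ ?_ ?_
      · simp only [SimpleGraph.Walk.length_cons, SimpleGraph.Walk.length_concat]
        exact (Nat.not_even_iff_odd.1 he).add_one.add_one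
      · simp only [SimpleGraph.Walk.support_cons, SimpleGraph.Walk.support_concat, List.mem_cons,
          List.mem_append, List.not_mem_nil, or_false]
        rintro z (rfl | h | rfl)
        · exact hsA
        · exact hkA z ((hsup z).1 (Or.inl h))
        · exact hsA
      · simp only [SimpleGraph.Walk.length_cons, SimpleGraph.Walk.length_concat]
        rw [Nat.not_even_iff_odd] at he
        rcases he with ⟨i, hi⟩; rcases hk with ⟨j, hj⟩; omega

/-- Two odd closed walks on disjoint vertex sets, each with a single vertex that has neighbours
elsewhere, together with a walk joining them violate the condition `SatisfiesSharp`. -/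
lemma not_satisfiesSharp {U : Set V} {x y : V} {c : G.Walk x x} {c' : G.Walk y y}
    {p : G.Walk x y} (hc : Odd c.length) (hc' : Odd c'.length)
    (hcU : ∀ z ∈ c.support, z ∈ U) (hcU' : ∀ z ∈ c'.support, z ∈ U) (hpU : ∀ z ∈ p.support, z ∈ U)
    (hdis : ∀ z ∈ c.support, z ∉ c'.support)
    (hA : ∀ z ∈ c.support, z ≠ x → ∀ u ∈ U, u ∉ c.support → ¬ G.Adj z u)
    (hA' : ∀ z ∈ c'.support, z ≠ y → ∀ u ∈ U, u ∉ c'.support → ¬ G.Adj z u) :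
    ¬ SatisfiesSharp G := by
  classical
  have hex : ∀ {s : V} (d : G.Walk s s), Odd d.length → ∃ n, ∃ (a : V) (k : G.Walk a a),
      k.length = n ∧ Odd n ∧ ∀ z ∈ k.support, z ∈ d.support :=
    fun d hd => ⟨_, _, d, rfl, hd, fun _ h => h⟩
  have hmin : ∀ {s : V} (d : G.Walk s s), Odd d.length → ∃ (a : V) (k : G.Walk a a),
      Odd k.length ∧ (∀ z ∈ k.support, z ∈ d.support) ∧
      ∀ (a' : V) (k' : G.Walk a' a'), Odd k'.length → (∀ z ∈ k'.support, z ∈ d.support) →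
      k.length ≤ k'.length := by
    intro s d hd
    obtain ⟨a, k, h1, h2, h3⟩ := Nat.find_spec (hex d hd)
    refine ⟨a, k, by rwa [h1], h3, fun a' k' ho hs => ?_⟩
    rw [h1]
    exact Nat.find_min' _ ⟨a', k', rfl, ho, hs⟩
  obtain ⟨a₀, k₀, hk₀, hkA₀, hm₀⟩ := hmin c hc
  obtain ⟨b₀, l₀, hl₀, hlA₀, hm₀'⟩ := hmin c' hc'
  -- The joining walk is minimised over all pairs of shortest odd closed walks and not for one fixed
  -- pair; `shortest_from_odd` relies on this freedom.
  have hpex : ∃ n, ∃ (a b : V) (k : G.Walk a a) (l : G.Walk b b) (q : G.Walk a b), q.length = n ∧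
      k.length = k₀.length ∧ l.length = l₀.length ∧ (∀ z ∈ k.support, z ∈ c.support) ∧
      (∀ z ∈ l.support, z ∈ c'.support) ∧ ∀ z ∈ q.support, z ∈ U := by
    obtain ⟨c₁, c₂, hc12⟩ := SimpleGraph.Walk.mem_support_iff_exists_append.1
      (hkA₀ a₀ k₀.start_mem_support)
    obtain ⟨d₁, d₂, hd12⟩ := SimpleGraph.Walk.mem_support_iff_exists_append.1
      (hlA₀ b₀ l₀.start_mem_support)
    refine ⟨_, a₀, b₀, k₀, l₀, c₂.append (p.append d₁), rfl, rfl, rfl, hkA₀, hlA₀, ?_⟩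
    simp only [SimpleGraph.Walk.mem_support_append_iff]
    rintro z (h | h | h)
    · exact hcU z (by simp [hc12, h])
    · exact hpU z h
    · exact hcU' z (by simp [hd12, h])
  obtain ⟨a, b, k, l, q, hq, hk, hl, hkA, hlA, hqU⟩ := Nat.find_spec hpex
  have hqmin : ∀ (a' b' : V) (k' : G.Walk a' a') (l' : G.Walk b' b') (q' : G.Walk a' b'),
      k'.length = k.length → l'.length = l.length → (∀ z ∈ k'.support, z ∈ c.support) →
      (∀ z ∈ l'.support, z ∈ c'.support) → (∀ z ∈ q'.support, z ∈ U) → q.length ≤ q'.length := by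
    intro a' b' k' l' q' h1 h2 h3 h4 h5
    rw [hq]
    exact Nat.find_min' _ ⟨a', b', k', l', q', rfl, h1.trans hk, h2.trans hl, h3, h4, h5⟩
  clear hq
  rw [← hk] at hm₀ hk₀
  rw [← hl] at hm₀' hl₀
  have haA := hkA a k.start_mem_support
  have hbA := hlA b l.start_mem_support
  have hab : a ≠ b := by rintro rfl; exact hdis _ haA hbA
  obtain ⟨hkc, hke⟩ := isCycle_and_mem_edges_of_shortest_odd hk₀
    (fun a' k' ho hs => hm₀ a' k' ho fun z hz => hkA z (hs z hz))
  obtain ⟨hlc, hle⟩ := isCycle_and_mem_edges_of_shortest_odd hl₀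
    (fun a' k' ho hs => hm₀' a' k' ho fun z hz => hlA z (hs z hz))
  obtain ⟨hqp, hqe⟩ := isPath_and_mem_edges_of_shortest (p := q)
    (fun q' hs => hqmin a b k l q' rfl rfl hkA hlA fun z hz => hqU z (hs z hz))
  obtain ⟨hqk, hqke⟩ := shortest_from_odd (A := {z | z ∈ c.support}) (p := q) hcU hA hk₀ hkA hqU hm₀
    (fun a' k' q' h1 h2 h3 => hqmin a' b k' l q' h1 rfl h2 hlA h3)
  obtain ⟨hql, hqle⟩ := shortest_from_odd (A := {z | z ∈ c'.support}) (p := q.reverse) hcU' hA' hl₀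
    hlA (by simpa using hqU) hm₀'
    (fun b' l' q' h1 h2 h3 => by
      have := hqmin a b' k l' q'.reverse rfl h1 hkA h2 (by simpa using h3)
      simpa using this)
  simp only [SimpleGraph.Walk.support_reverse, List.mem_reverse,
    SimpleGraph.Walk.edges_reverse] at hql hqle
  have hkl : ∀ s ∈ k.support, ∀ t ∈ l.support, G.Adj s t → s(s, t) ∈ q.edges := by
    intro s hs t ht hst
    -- The only possible edge between the two sides joins `x` to `y`. If it joins `k` to `l`, the
    -- minimal joining walk has length one and is this edge.
    have out : ∀ s ∈ c.support, ∀ t ∈ c'.support, G.Adj s t → s = x ∧ t = y := by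
      intro s hs t ht hst
      constructor
      · by_contra h
        exact hA s hs h t (hcU' t ht) (fun h' => hdis t h' ht) hst
      · by_contra h
        exact hA' t ht h s (hcU s hs) (hdis s hs) hst.symm
    obtain ⟨rfl, rfl⟩ := out s (hkA s hs) t (hlA t ht) hst
    obtain ⟨k', hk', hs'⟩ := exists_closed_at k hs
    obtain ⟨l', hl', ht'⟩ := exists_closed_at l ht
    have h1 := hqmin s t k' l' (.cons hst .nil) hk' hl' (fun z hz => hkA z ((hs' z).1 hz))
      (fun z hz => hlA z ((ht' z).1 hz)) (by
        simp only [SimpleGraph.Walk.support_cons, SimpleGraph.Walk.support_nil, List.mem_cons,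
          List.not_mem_nil, or_false]
        rintro z (rfl | rfl)
        · exact hcU _ (hkA _ hs)
        · exact hcU' _ (hlA _ ht))
    have h2 := length_pos_of_ne q hab
    simp only [SimpleGraph.Walk.length_cons, SimpleGraph.Walk.length_nil] at h1
    have h3 : q.length = 1 := by omega
    obtain ⟨rfl, rfl⟩ := out a haA b hbA (SimpleGraph.Walk.adj_of_length_eq_one h3)
    exact edge_mem_of_length_one q h3
  intro hsharp
  refine hsharp ⟨a, b, k, l, q, hkc, hk₀, hlc, hl₀, hqp, length_pos_of_ne q hab,
    fun z hz hz' => hdis z (hkA z hz) (hlA z hz'), hqk, hql, ?_⟩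
  intro s t hs ht hst
  have hts : G.Adj t s := hst.symm
  have hsw : s(t, s) = s(s, t) := Sym2.eq_swap
  by_cases hsk : s ∈ k.support
  · by_cases htk : t ∈ k.support
    · exact Or.inl (hke s hsk t htk hst)
    · rcases ht with h | h | h
      · exact absurd h htk
      · exact Or.inr (Or.inr (hkl s hsk t h hst))
      · exact Or.inr (Or.inr (hsw ▸ hqke t h s hsk htk hts))
  · by_cases hsl : s ∈ l.support
    · by_cases htl : t ∈ l.support
      · exact Or.inr (Or.inl (hle s hsl t htl hst))
      · rcases ht with h | h | h
        · exact Or.inr (Or.inr (hsw ▸ hkl t h s hsl hts))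
        · exact absurd h htl
        · exact Or.inr (Or.inr (hsw ▸ hqle t h s hsl htl hts))
    · have hsq : s ∈ q.support := by tauto
      rcases ht with h | h | h
      · exact Or.inr (Or.inr (hqke s hsq t h hsk hst))
      · exact Or.inr (Or.inr (hqle s hsq t h hsl hst))
      · exact Or.inr (Or.inr (hqe s hsq t h hst))

end Induced

end ToricGraph

namespace ToricGraph

/-! ### Unlinked pairs come from cycles -/

section Dichotomy

variable {V : Type*} {G : SimpleGraph V}

/-- The pair of monomials comes from an even cycle, or from two odd cycles with exactly one common
vertex. -/
def CirclePair (R B : G.edgeSet →₀ ℕ) : Prop :=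
  (∃ (a : V) (w : G.Walk a a), w.IsCycle ∧ Even w.length ∧
    ((walkPlus w = R ∧ walkMinus w = B) ∨ (walkPlus w = B ∧ walkMinus w = R))) ∨
  ∃ (x : V) (c q : G.Walk x x), c.IsCycle ∧ q.IsCycle ∧ ¬ Even c.length ∧ ¬ Even q.length ∧
    (∀ z ∈ c.support, z ∈ q.support → z = x) ∧
    ((walkPlus (c.append q) = R ∧ walkMinus (c.append q) = B) ∨
      (walkPlus (c.append q) = B ∧ walkMinus (c.append q) = R))

lemma exists_closed_decomposition {a : V} {w : G.Walk a a} (hl : 0 < w.length)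
    (h : ¬ w.support.tail.Nodup) :
    ∃ (x : V) (p : G.Walk a x) (c : G.Walk x x) (q : G.Walk x a),
      w = p.append (c.append q) ∧ 0 < p.length ∧ 0 < c.length ∧ c.support.tail.Nodup := by
  cases w with
  | nil => simp at hl
  | cons hadj p =>
    obtain ⟨x, p', c, q, rfl, h1, h2⟩ := exists_closed_subwalk p (by simpa using h)
    exact ⟨x, .cons hadj p', c, q, by simp, by simp, h1, h2⟩

lemma isCycle_of_odd {a : V} {w : G.Walk a a} (h : w.support.tail.Nodup)
    (hl : ¬ Even w.length) : w.IsCycle := by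
  refine isCycle_of_nodup h ?_
  have h1 : w.length ≠ 1 := fun h1 =>
    G.irrefl (SimpleGraph.Walk.adj_of_length_eq_one h1)
  rw [Nat.not_even_iff_odd] at hl
  obtain ⟨k, hk⟩ := hl
  omega

variable [Fintype V] [DecidableEq V] [DecidableRel G.Adj]

lemma ChordSplit.altEq {a b : V} {w : G.Walk a a} {w' : G.Walk b b}
    (h : ChordSplit (walkPlus w') (walkMinus w')) (hw : AltEq w w') :
    ChordSplit (walkPlus w) (walkMinus w) := by
  rcases hw with ⟨h1, h2⟩ | ⟨h1, h2⟩
  · rwa [h1, h2]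
  · rw [h1, h2]; exact h.symm

/-- Cut off closed subwalks without repeated vertices. If more than two pieces arise, two odd cycles
with different base points appear; either an edge leaves one of them away from its base point and
splits the pair, or both are attached at one vertex only and (♯) fails. -/
lemma Primitive.circlePair_or_chordSplit (hsharp : SatisfiesSharp G) {a : V} {w : G.Walk a a}
    (hw : Primitive w) (hdis : ∀ e, walkPlus w e = 0 ∨ walkMinus w e = 0) :
    CirclePair (walkPlus w) (walkMinus w) ∨ ChordSplit (walkPlus w) (walkMinus w) := by
  by_cases hnd : w.support.tail.Nodup
  · refine Or.inl (Or.inl ⟨a, w, isCycle_of_nodup hnd ?_, hw.1, Or.inl ⟨rfl, rfl⟩⟩)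
    obtain ⟨k, hk⟩ := hw.1
    have := hw.2.1
    -- A closed walk of length two repeats its edge, which would then divide both monomials.
    by_contra hlt
    cases w with
    | nil => simp at this
    | cons h p =>
      cases p with
      | nil => simp at hk; omega
      | cons h' p =>
        cases p with
        | nil =>
          have := hdis ⟨s(a, _), h⟩
          simp [walkPlus_cons, walkMinus_cons, edgeExp_apply] at this
        | cons => simp at hlt
  · obtain ⟨x, p, c, q, rfl, hp, hc, hcn⟩ := exists_closed_decomposition hw.2.1 hnd
    have hE : AltEq (p.append (c.append q)) (c.append (q.append p)) := by
      rw [SimpleGraph.Walk.append_assoc c]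
      exact AltEq.rotate _ _ (by simpa using hw.1)
    have hw' := hw.altEq hE
    have hq' : 0 < (q.append p).length := by simp; omega
    generalize q.append p = q' at hE hw' hq'
    have hco := hw'.odd_left hc hq'
    have hcC := isCycle_of_odd hcn hco
    have hqo : ¬ Even q'.length := by
      have := hw'.1
      simp only [SimpleGraph.Walk.length_append, Nat.even_add] at this
      tauto
    by_cases hqn : q'.support.tail.Nodup
    · refine Or.inl (Or.inr ⟨x, c, q', hcC, isCycle_of_odd hqn hqo, hco, hqo,
        fun z h1 h2 => hw'.inter_eq h1 h2, ?_⟩)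
      rcases hE with ⟨h1, h2⟩ | ⟨h1, h2⟩
      · exact Or.inl ⟨h1.symm, h2.symm⟩
      · exact Or.inr ⟨h2.symm, h1.symm⟩
    · right
      obtain ⟨y, p₁, c₂, p₂, rfl, hp₁, hc₂, hcn₂⟩ := exists_closed_decomposition hq' hqn
      have hw1 : Primitive ((c.append p₁).append (c₂.append p₂)) := by
        rwa [← SimpleGraph.Walk.append_assoc]
      have hE2 : AltEq (c.append (p₁.append (c₂.append p₂)))
          (c₂.append (p₂.append (c.append p₁))) := by
        rw [SimpleGraph.Walk.append_assoc c, SimpleGraph.Walk.append_assoc c₂]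
        exact AltEq.rotate _ _ (by simpa only [SimpleGraph.Walk.length_append] using hw1.1)
      have hw2 := hw'.altEq hE2
      have hco₂ := hw2.odd_left hc₂ (by simp; omega)
      have hcC₂ := isCycle_of_odd hcn₂ hco₂
      -- With equal base points, `c` and `p₁` would be odd closed walks at `x`, and their
      -- concatenation an even closed subwalk.
      have hyx : y ≠ x := by
        rintro rfl
        have h1 := hw1.odd_left (by simp; omega) (by simp; omega)
        have h2 : Primitive (p₁.append ((c₂.append p₂).append c)) := by
          rw [SimpleGraph.Walk.append_assoc]; exact hw'.rotate
        have h3 := h2.odd_left hp₁ (by simp; omega)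
        simp only [SimpleGraph.Walk.length_append, Nat.even_add] at h1
        tauto
      by_contra hch
      refine not_satisfiesSharp (c := c) (c' := c₂) (p := p₁)
        (U := {z | z ∈ (c.append (p₁.append (c₂.append p₂))).support})
        (Nat.not_even_iff_odd.1 hco) (Nat.not_even_iff_odd.1 hco₂) ?_ ?_ ?_ ?_ ?_ ?_ hsharp
      · intro z hz; simp [SimpleGraph.Walk.mem_support_append_iff, hz]
      · intro z hz; simp [SimpleGraph.Walk.mem_support_append_iff, hz]
      · intro z hz; simp [SimpleGraph.Walk.mem_support_append_iff, hz]
      · intro z hz hz'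
        have h1 := hw'.inter_eq hz (by simp [SimpleGraph.Walk.mem_support_append_iff, hz'])
        have h2 := hw2.inter_eq hz' (by simp [SimpleGraph.Walk.mem_support_append_iff, hz])
        exact hyx (h2.symm.trans h1)
      · intro z hz hzx u hu huc hzu
        refine hch ((hw'.chordSplit hcC hq' hz ?_ hzx ?_ hzu).altEq hE)
        · exact ((SimpleGraph.Walk.mem_support_append_iff _ _).1 hu).resolve_left huc
        · rintro rfl; exact huc c.start_mem_support
      · intro z hz hzx u hu huc hzu
        refine hch ((hw2.chordSplit hcC₂ (by simp; omega) hz ?_ hzx ?_ hzu).altEq (hE.trans hE2))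
        · simp only [Set.mem_ofPred_eq, SimpleGraph.Walk.mem_support_append_iff] at hu ⊢
          tauto
        · rintro rfl; exact huc c₂.start_mem_support

lemma eq_of_le_of_vdeg_eq {m n : G.edgeSet →₀ ℕ} (h : m ≤ n) (hD : vdeg m = vdeg n) : m = n := by
  obtain ⟨k, rfl⟩ := le_iff_exists_add.1 h
  rw [vdeg_add, left_eq_add] at hD
  simp [vdeg_eq_zero.1 hD]

/-- Take a shortest even closed walk alternating inside `(R, B)`. If it exhausts the pair it is
primitive; otherwise the remainder gives a `PairSplit`. -/
lemma circlePair_or_split (hsharp : SatisfiesSharp G) {R B : G.edgeSet →₀ ℕ}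
    (hD : vdeg R = vdeg B) (hR : R ≠ 0) (hdis : ∀ e, R e = 0 ∨ B e = 0) :
    CirclePair R B ∨ PairSplit R B ∨ ChordSplit R B := by
  classical
  have hex : ∃ n, ∃ (a : V) (w : G.Walk a a), w.length = n ∧ Even w.length ∧ 0 < w.length ∧
      walkPlus w ≤ R ∧ walkMinus w ≤ B := by
    obtain ⟨a, w, h⟩ := exists_alternating hD hR
    exact ⟨_, a, w, rfl, h⟩
  obtain ⟨a, w, hn, he, hl, hP, hM⟩ := Nat.find_spec hex
  have hmin : ∀ (b : V) (w' : G.Walk b b), Even w'.length → 0 < w'.length →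
      walkPlus w' ≤ R → walkMinus w' ≤ B → w.length ≤ w'.length := by
    intro b w' h1 h2 h3 h4
    rw [hn]
    exact Nat.find_min' _ ⟨b, w', rfl, h1, h2, h3, h4⟩
  by_cases hRw : walkPlus w = R
  · have hBw : walkMinus w = B :=
      eq_of_le_of_vdeg_eq hM (by rw [← vdeg_walk_closed he, hRw, hD])
    have hw : Primitive w := by
      refine ⟨he, hl, fun b w' h1 h2 h3 => ?_⟩
      rcases h3 with ⟨h3, h4⟩ | ⟨h3, h4⟩
      · exact hmin b w' h1 h2 (h3.trans hP) (h4.trans hM)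
      · have := hmin b w'.reverse (by simpa using h1) (by simpa using h2)
          (by rw [walkPlus_reverse, if_pos h1]; exact h4.trans hP)
          (by rw [walkMinus_reverse, if_pos h1]; exact h3.trans hM)
        simpa using this
    have := hw.circlePair_or_chordSplit hsharp (by rw [hRw, hBw]; exact hdis)
    rw [hRw, hBw] at this
    tauto
  · right; left
    obtain ⟨R', rfl⟩ := le_iff_exists_add.1 hP
    obtain ⟨B', rfl⟩ := le_iff_exists_add.1 hM
    have hD' : vdeg R' = vdeg B' := by
      rw [vdeg_add, vdeg_add, vdeg_walk_closed he] at hD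
      exact add_left_cancel hD
    have hR' : R' ≠ 0 := by rintro rfl; simp at hRw
    refine ⟨_, R', _, B', rfl, rfl, vdeg_walk_closed he, walkPlus_ne_zero hl, hR',
      walkMinus_ne_zero ?_, ?_⟩
    · obtain ⟨k, hk⟩ := he; omega
    · rintro rfl
      rw [vdeg_zero] at hD'
      exact hR' (vdeg_eq_zero.1 hD')

lemma circlePair_of_not_linked (hsharp : SatisfiesSharp G) {R B : G.edgeSet →₀ ℕ}
    (hD : vdeg R = vdeg B) (h : ¬ Linked R B) : CirclePair R B := by
  have hdis : ∀ e, R e = 0 ∨ B e = 0 := by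
    intro e
    by_contra hne
    push Not at hne
    exact h (Linked.of_common hD hne.1 hne.2)
  have hR : R ≠ 0 := by
    rintro rfl
    rw [vdeg_zero] at hD
    rw [vdeg_eq_zero.1 hD.symm] at h
    exact h Relation.ReflTransGen.refl
  rcases circlePair_or_split hsharp hD hR hdis with h' | h' | h'
  · exact h'
  · exact absurd (h'.linked hD) h
  · exact absurd h'.linked h

/-- A squarefree monomial that shares no variable with any other monomial of its degree, and is not
the only monomial of its degree. -/
structure IsolatedMonomial (m : G.edgeSet →₀ ℕ) : Prop where
  squarefree : IsSquarefreeExp m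
  disjoint : ∀ n, vdeg n = vdeg m → n ≠ m → ∀ e, m e = 0 ∨ n e = 0
  exists_ne : ∃ n, vdeg n = vdeg m ∧ n ≠ m

/-- Write `m = R + Y`; then `B + Y` is another monomial of the fibre of `m`, and a variable of `Y`
would be common to both. -/
lemma IsolatedMonomial.eq_of_le {m R B : G.edgeSet →₀ ℕ} (hm : IsolatedMonomial m) (hR : R ≤ m)
    (hD : vdeg R = vdeg B) (hne : R ≠ B) : R = m := by
  obtain ⟨Y, rfl⟩ := le_iff_exists_add.1 hR
  have : Y = 0 := by
    ext e
    have := hm.disjoint (B + Y) (by simp [hD]) (by simpa using hne.symm) e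
    simp only [Finsupp.add_apply] at this
    simp only [Finsupp.coe_zero, Pi.zero_apply]
    omega
  simp [this]

end Dichotomy

end ToricGraph

namespace ToricGraph

/-! ### Even cycles and pairs of odd cycles are circuits -/

section Circuits

variable {V : Type*} {G : SimpleGraph V}

lemma edges_disjoint_of_support {x : V} {c q : G.Walk x x}
    (h : ∀ z ∈ c.support, z ∈ q.support → z = x) : ∀ e ∈ c.edges, e ∉ q.edges := by
  intro e
  induction e with
  | _ s t =>
    intro hc hq
    have h1 := h s (c.fst_mem_support_of_mem_edges hc) (q.fst_mem_support_of_mem_edges hq)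
    have h2 := h t (c.snd_mem_support_of_mem_edges hc) (q.snd_mem_support_of_mem_edges hq)
    exact (c.adj_of_mem_edges hc).ne (h1.trans h2.symm)

/-- The even closed walk of a pair of monomials coming from an even cycle or from two odd cycles. -/
lemma CirclePair.exists_walk {R B : G.edgeSet →₀ ℕ} (h : CirclePair R B) :
    ∃ (a : V) (w : G.Walk a a), Even w.length ∧ w.edges.Nodup ∧
      walkPlus w = R ∧ walkMinus w = B := by
  have key : ∀ (a : V) (w : G.Walk a a), Even w.length → w.edges.Nodup →
      ((walkPlus w = R ∧ walkMinus w = B) ∨ (walkPlus w = B ∧ walkMinus w = R)) →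
      ∃ (a : V) (w : G.Walk a a), Even w.length ∧ w.edges.Nodup ∧
        walkPlus w = R ∧ walkMinus w = B := by
    rintro a w he hn (⟨h1, h2⟩ | ⟨h1, h2⟩)
    · exact ⟨a, w, he, hn, h1, h2⟩
    · exact ⟨a, w.reverse, by simpa using he, by simpa using hn,
        by rw [walkPlus_reverse, if_pos he, h2], by rw [walkMinus_reverse, if_pos he, h1]⟩
  rcases h with ⟨a, w, h1, h2, h3⟩ | ⟨x, c, q, h1, h2, h3, h4, h5, h6⟩
  · exact key a w h2 h1.edges_nodup h3
  · refine key x (c.append q) ?_ ?_ h6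
    · rw [SimpleGraph.Walk.length_append, Nat.even_add]; tauto
    · rw [SimpleGraph.Walk.edges_append, List.nodup_append]
      refine ⟨h1.edges_nodup, h2.edges_nodup, ?_⟩
      rintro e he f hf rfl
      exact edges_disjoint_of_support h5 e he hf

lemma CirclePair.add_le_one {R B : G.edgeSet →₀ ℕ} (h : CirclePair R B) (e : G.edgeSet) :
    R e + B e ≤ 1 := by
  classical
  obtain ⟨a, w, -, hn, rfl, rfl⟩ := h.exists_walk
  rw [walkPlus_add_walkMinus_apply]
  exact List.nodup_iff_count_le_one.1 hn _

lemma alternating_of_consecutive {f : G.edgeSet → ℤ} {a b : V} (p : G.Walk a b)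
    (hp : p.edges.Nodup)
    (hf : ∀ (s y t : V) (p₁ : G.Walk a s) (h : G.Adj s y) (h' : G.Adj y t) (p₂ : G.Walk t b),
      p = p₁.append (.cons h (.cons h' p₂)) → f ⟨s(s, y), h⟩ + f ⟨s(y, t), h'⟩ = 0) :
    ∃ α : ℤ, ∀ e : G.edgeSet, (e : Sym2 V) ∈ p.edges →
      f e = α * ((walkPlus p e : ℤ) - walkMinus p e) := by
  classical
  induction p with
  | nil => exact ⟨0, by simp⟩
  | @cons u v w h p ih =>
    rw [SimpleGraph.Walk.edges_cons, List.nodup_cons] at hp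
    have hz : ∀ e : G.edgeSet, (e : Sym2 V) ∉ p.edges → walkPlus p e = 0 ∧ walkMinus p e = 0 := by
      intro e he
      rw [mem_edges_iff] at he
      tauto
    obtain ⟨α, hα⟩ := ih hp.2 (fun s y t p₁ h₁ h₂ p₂ he =>
      hf s y t (.cons h p₁) h₁ h₂ p₂ (by rw [he, SimpleGraph.Walk.cons_append]))
    cases p with
    | nil =>
      refine ⟨f ⟨s(u, v), h⟩, ?_⟩
      rintro ⟨e, he⟩ hmem
      simp only [SimpleGraph.Walk.edges_cons, SimpleGraph.Walk.edges_nil, List.mem_singleton] at hmem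
      subst hmem
      simp [walkPlus_cons, walkMinus_cons, edgeExp_apply]
    | @cons _ t _ h' r =>
      have h0 := hf u v t .nil h h' r rfl
      have h1 := hα ⟨s(v, t), h'⟩ (by simp)
      have h2 : walkPlus r ⟨s(v, t), h'⟩ = 0 ∧ walkMinus r ⟨s(v, t), h'⟩ = 0 := by
        have : s(v, t) ∉ r.edges := by
          have := hp.2
          rw [SimpleGraph.Walk.edges_cons, List.nodup_cons] at this
          exact this.1
        have := mt (mem_edges_iff r ⟨s(v, t), h'⟩).2 this
        tauto
      rw [walkPlus_cons, walkMinus_cons, Finsupp.add_apply, edgeExp_apply, h2.1, h2.2] at h1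
      simp only [if_true, add_zero, Nat.cast_one, Nat.cast_zero, sub_zero, mul_one] at h1
      refine ⟨-α, fun e he => ?_⟩
      rw [SimpleGraph.Walk.edges_cons, List.mem_cons] at he
      rw [walkPlus_cons h, walkMinus_cons h, Finsupp.add_apply, edgeExp_apply]
      by_cases he' : (e : Sym2 V) = s(u, v)
      · have h3 := hz e (by rw [he']; exact hp.1)
        have h4 : e = ⟨s(u, v), h⟩ := Subtype.ext he'
        rw [if_pos he', h3.1, h3.2, h4]
        simp only [add_zero, Nat.cast_one, Nat.cast_zero, sub_zero, mul_one]
        linarith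
      · rw [hα e (he.resolve_left he'), if_neg he']
        push_cast
        ring

variable [Fintype V] [DecidableEq V] [DecidableRel G.Adj]

lemma CirclePair.vdeg_eq {R B : G.edgeSet →₀ ℕ} (h : CirclePair R B) : vdeg R = vdeg B := by
  obtain ⟨a, w, he, -, rfl, rfl⟩ := h.exists_walk
  exact vdeg_walk_closed he

lemma mem_kerZ_iff {f : G.edgeSet → ℤ} :
    f ∈ kerZ (edgeVectors G) ↔ ∀ y : V, ∑ e : G.edgeSet, (if y ∈ (e : Sym2 V) then f e else 0) = 0 := by
  have : f ∈ kerZ (edgeVectors G) ↔ ∑ e, f e • edgeVectors G e = 0 := Iff.rfl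
  rw [this, funext_iff]
  refine forall_congr' fun y => ?_
  simp [Finset.sum_apply, edgeVectors]

/-- Away from `x` only the two cycle edges at a vertex can carry `f`, so the relation at that vertex
makes the two values opposite. Nothing is asked at `x`, where a second cycle may be attached. -/
lemma alternating_on_cycle {f : G.edgeSet → ℤ} (hf : f ∈ kerZ (edgeVectors G)) {x : V}
    {c : G.Walk x x} (hc : c.IsCycle)
    (hs : ∀ y ∈ c.support, y ≠ x → ∀ e : G.edgeSet, y ∈ (e : Sym2 V) → f e ≠ 0 →
      (e : Sym2 V) ∈ c.edges) :
    ∃ α : ℤ, ∀ e : G.edgeSet, (e : Sym2 V) ∈ c.edges →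
      f e = α * ((walkPlus c e : ℤ) - walkMinus c e) := by
  refine alternating_of_consecutive c hc.edges_nodup ?_
  rintro s y t p₁ h h' p₂ rfl
  have hnd := hc.support_nodup
  have hed := hc.edges_nodup
  have hsup : (p₁.append (.cons h (.cons h' p₂))).support.tail =
      p₁.support.tail ++ y :: p₂.support := by
    rw [SimpleGraph.Walk.tail_support_append]
    simp
  rw [hsup, List.nodup_append, List.nodup_cons] at hnd
  have hp₂ : y ∉ p₂.support := hnd.2.1.1
  have hyx : y ≠ x := by
    rintro rfl; exact hp₂ p₂.end_mem_support
  have hp₁ : y ∉ p₁.support := by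
    rw [← p₁.cons_tail_support, List.mem_cons]
    rintro (h1 | h1)
    · exact hyx h1
    · exact hnd.2.2 y h1 y (by simp) rfl
  have hne : (⟨s(s, y), h⟩ : G.edgeSet) ≠ ⟨s(y, t), h'⟩ := by
    intro heq
    have heq' : s(s, y) = s(y, t) := congrArg Subtype.val heq
    simp only [SimpleGraph.Walk.edges_append, SimpleGraph.Walk.edges_cons, List.nodup_append,
      List.nodup_cons, heq', List.mem_cons] at hed
    exact hed.2.1.1 (Or.inl trivial)
  have hsum := mem_kerZ_iff.1 hf y
  rw [Fintype.sum_eq_add (⟨s(s, y), h⟩ : G.edgeSet) ⟨s(y, t), h'⟩ hne] at hsum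
  · simpa using hsum
  · rintro e ⟨h1, h2⟩
    split_ifs with hye
    · by_contra hfe
      have := hs y (by simp [SimpleGraph.Walk.mem_support_append_iff]) hyx e hye hfe
      simp only [SimpleGraph.Walk.edges_append, SimpleGraph.Walk.edges_cons, List.mem_append,
        List.mem_cons] at this
      rcases this with h3 | h3 | h3 | h3
      · exact hp₁ (SimpleGraph.Walk.mem_support_iff_exists_mem_edges.2 (Or.inr ⟨e, h3, hye⟩))
      · exact h1 (Subtype.ext h3)
      · exact h2 (Subtype.ext h3)
      · exact hp₂ (SimpleGraph.Walk.mem_support_iff_exists_mem_edges.2 (Or.inr ⟨e, h3, hye⟩))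
    · rfl

lemma sum_sub_eq_vdeg (m n : G.edgeSet →₀ ℕ) (y : V) :
    ∑ e : G.edgeSet, (if y ∈ (e : Sym2 V) then ((m e : ℤ) - n e) else 0) =
      (vdeg m y : ℤ) - vdeg n y := by
  simp only [vdeg, Nat.cast_sum, ← Finset.sum_sub_distrib]
  exact Finset.sum_congr rfl fun e _ => by split_ifs <;> simp

/-- The relations supported on an even cycle, or on two odd cycles with one common vertex, are
multiples of a single one. -/
lemma CirclePair.eq_mul {R B : G.edgeSet →₀ ℕ} (h : CirclePair R B) {f : G.edgeSet → ℤ}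
    (hf : f ∈ kerZ (edgeVectors G)) (hs : ∀ e, f e ≠ 0 → R e ≠ 0 ∨ B e ≠ 0) :
    ∃ α : ℤ, ∀ e, f e = α * ((R e : ℤ) - B e) := by
  rcases h with ⟨a, w, hc, he, hw⟩ | ⟨x, c, q, hc, hq, hco, hqo, hcq, hw⟩
  · have hsw : ∀ e : G.edgeSet, f e ≠ 0 → (e : Sym2 V) ∈ w.edges := by
      intro e hfe
      rw [mem_edges_iff]
      rcases hw with ⟨h1, h2⟩ | ⟨h1, h2⟩ <;> rw [h1, h2]
      · exact hs e hfe
      · exact (hs e hfe).symm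
    obtain ⟨α, hα⟩ := alternating_on_cycle hf hc fun y _ _ e _ hfe => hsw e hfe
    have hα' : ∀ e, f e = α * ((walkPlus w e : ℤ) - walkMinus w e) := by
      intro e
      by_cases hmem : (e : Sym2 V) ∈ w.edges
      · exact hα e hmem
      · rw [by_contra fun hfe => hmem (hsw e hfe)]
        rw [mem_edges_iff] at hmem
        push Not at hmem
        simp [hmem.1, hmem.2]
    rcases hw with ⟨rfl, rfl⟩ | ⟨rfl, rfl⟩
    · exact ⟨α, hα'⟩
    · exact ⟨-α, fun e => by rw [hα' e]; ring⟩
  · have hdis := edges_disjoint_of_support hcq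
    have hsw : ∀ e : G.edgeSet, f e ≠ 0 → (e : Sym2 V) ∈ c.edges ∨ (e : Sym2 V) ∈ q.edges := by
      intro e hfe
      rw [← List.mem_append, ← SimpleGraph.Walk.edges_append, mem_edges_iff]
      rcases hw with ⟨h1, h2⟩ | ⟨h1, h2⟩ <;> rw [h1, h2]
      · exact hs e hfe
      · exact (hs e hfe).symm
    have hmem : ∀ (p : G.Walk x x) (y : V) (e : G.edgeSet), y ∈ (e : Sym2 V) →
        (e : Sym2 V) ∈ p.edges → y ∈ p.support := fun p y e hy he =>
      SimpleGraph.Walk.mem_support_iff_exists_mem_edges.2 (Or.inr ⟨e, he, hy⟩)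
    obtain ⟨α, hα⟩ := alternating_on_cycle hf hc fun y hy hyx e hye hfe =>
      (hsw e hfe).resolve_right fun h => hyx (hcq y hy (hmem q y e hye h))
    obtain ⟨β, hβ⟩ := alternating_on_cycle hf hq fun y hy hyx e hye hfe =>
      (hsw e hfe).resolve_left fun h => hyx (hcq y (hmem c y e hye h) hy)
    have hz : ∀ (p : G.Walk x x) (e : G.edgeSet), (e : Sym2 V) ∉ p.edges →
        walkPlus p e = 0 ∧ walkMinus p e = 0 := by
      intro p e he
      rw [mem_edges_iff] at he
      tauto
    have hfab : ∀ e, f e = α * ((walkPlus c e : ℤ) - walkMinus c e) +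
        β * ((walkPlus q e : ℤ) - walkMinus q e) := by
      intro e
      by_cases h1 : (e : Sym2 V) ∈ c.edges
      · rw [hα e h1, (hz q e (hdis e h1)).1, (hz q e (hdis e h1)).2]; simp
      · by_cases h2 : (e : Sym2 V) ∈ q.edges
        · rw [hβ e h2, (hz c e h1).1, (hz c e h1).2]; simp
        · rw [by_contra fun hfe => (hsw e hfe).elim h1 h2, (hz c e h1).1, (hz c e h1).2,
            (hz q e h2).1, (hz q e h2).2]
          simp
    -- At the common vertex each odd cycle has degree difference two, so the relation reads `2α + 2β
    -- = 0`.
    have hsum := mem_kerZ_iff.1 hf x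
    have hsplit : ∀ e : G.edgeSet, (if x ∈ (e : Sym2 V) then f e else 0) =
        α * (if x ∈ (e : Sym2 V) then ((walkPlus c e : ℤ) - walkMinus c e) else 0) +
        β * (if x ∈ (e : Sym2 V) then ((walkPlus q e : ℤ) - walkMinus q e) else 0) := by
      intro e
      split_ifs
      · exact hfab e
      · simp
    rw [Finset.sum_congr rfl fun e _ => hsplit e, Finset.sum_add_distrib, ← Finset.mul_sum,
      ← Finset.mul_sum, sum_sub_eq_vdeg, sum_sub_eq_vdeg, vdeg_walk_odd hco, vdeg_walk_odd hqo]
      at hsum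
    simp only [Pi.add_apply, Pi.single_eq_same, Nat.cast_add, Nat.cast_one] at hsum
    have hβα : β = -α := by linarith
    have hα' : ∀ e, f e = α * ((walkPlus (c.append q) e : ℤ) - walkMinus (c.append q) e) := by
      intro e
      rw [hfab e, walkPlus_append, walkMinus_append, if_neg hco, if_neg hco, hβα]
      simp only [Finsupp.add_apply, Nat.cast_add]
      ring
    rcases hw with ⟨rfl, rfl⟩ | ⟨rfl, rfl⟩
    · exact ⟨α, hα'⟩
    · exact ⟨-α, fun e => by rw [hα' e]; ring⟩

lemma sub_mem_kerZ {R B : G.edgeSet →₀ ℕ} (h : vdeg R = vdeg B) :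
    (fun e => (R e : ℤ) - B e) ∈ kerZ (edgeVectors G) := by
  rw [mem_kerZ_iff]
  intro y
  rw [sum_sub_eq_vdeg, h, sub_self]

/-- By `CirclePair.eq_mul` a nonzero relation supported inside is a nonzero multiple, so its support
is not smaller. The coordinate at a variable of `R` is one, whence coprimality. -/
lemma CirclePair.isCircuit {K : Type*} [Field K] {R B : G.edgeSet →₀ ℕ} (h : CirclePair R B)
    (hR : R ≠ 0) :
    IsCircuit (edgeVectors G)
      (MvPolynomial.monomial R 1 - MvPolynomial.monomial B 1 : MvPolynomial G.edgeSet K) := by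
  have h1 := h.add_le_one
  obtain ⟨e₀, he₀⟩ := Finsupp.ne_iff.1 hR
  have he₀' : (R e₀ : ℤ) - B e₀ = 1 := by
    have := h1 e₀
    simp only [Finsupp.coe_zero, Pi.zero_apply] at he₀
    omega
  refine ⟨fun e => (R e : ℤ) - B e, ⟨sub_mem_kerZ h.vdeg_eq, ?_, ?_, ?_⟩, ?_⟩
  · intro h0
    have := congrFun h0 e₀
    simp only [Pi.zero_apply] at this
    omega
  · intro f hf hf0 hss
    obtain ⟨α, hα⟩ := h.eq_mul hf fun e hfe => by
      have := hss.1 hfe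
      simp only [Function.mem_support] at this
      omega
    have hα0 : α ≠ 0 := by
      rintro rfl
      exact hf0 (funext fun e => by simp [hα e])
    refine hss.2 fun e he => ?_
    rw [Function.mem_support] at he ⊢
    rw [hα e]
    exact mul_ne_zero hα0 he
  · have hd : Finset.univ.gcd (fun e => (R e : ℤ) - B e) ∣ 1 := by
      rw [← he₀']
      exact Finset.gcd_dvd (Finset.mem_univ e₀)
    rw [← Finset.normalize_gcd]
    exact normalize_eq_one.2 (isUnit_of_dvd_one hd)
  · have hp : posExp (fun e => (R e : ℤ) - B e) = R := by
      ext e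
      have := h1 e
      simp only [posExp, Finsupp.equivFunOnFinite_symm_apply_apply]
      omega
    have hn : negExp (fun e => (R e : ℤ) - B e) = B := by
      ext e
      have := h1 e
      simp only [negExp, Finsupp.equivFunOnFinite_symm_apply_apply]
      omega
    rw [vecBinomial, hp, hn]

end Circuits

/-! ### Binomials supported on isolated monomials -/

section Isolated

variable {V : Type*} {G : SimpleGraph V}

lemma exists_common_edge {R B : G.edgeSet →₀ ℕ} {e : G.edgeSet} (hR : R e ≠ 0) (hB : B e ≠ 0) :
    ∃ g R' B' : G.edgeSet →₀ ℕ, g.degree = 1 ∧ R = g + R' ∧ B = g + B' := by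
  obtain ⟨R', hR'⟩ := le_iff_exists_add.1 (Finsupp.single_le_iff.2 (Nat.one_le_iff_ne_zero.2 hR))
  obtain ⟨B', hB'⟩ := le_iff_exists_add.1 (Finsupp.single_le_iff.2 (Nat.one_le_iff_ne_zero.2 hB))
  exact ⟨_, R', B', by simp, hR', hB'⟩

/-- Guarantees that the smaller pairs obtained from a split are again pairs of distinct monomials,
as the inductions below require. -/
lemma ne_of_disjoint {R₁ R₂ B₁ B₂ C : G.edgeSet →₀ ℕ} (hB : B₁ ≠ 0)
    (hdis : ∀ e, (R₁ + R₂) e = 0 ∨ (B₁ + B₂) e = 0) : R₁ ≠ B₁ + C := by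
  rintro rfl
  obtain ⟨e, he⟩ := Finsupp.ne_iff.1 hB
  have := hdis e
  simp only [Finsupp.add_apply, Finsupp.coe_zero, Pi.zero_apply] at this he
  omega

lemma degree_lt_of_add {m n : G.edgeSet →₀ ℕ} (hn : n ≠ 0) : m.degree < (m + n).degree := by
  have : n.degree ≠ 0 := fun h => hn ((Finsupp.degree_eq_zero_iff n).1 h)
  rw [map_add]
  omega

lemma support_subset_of_le {m n : G.edgeSet →₀ ℕ} (h : m ≤ n) : m.support ⊆ n.support :=
  Finsupp.support_mono h

/-- A squarefree monomial dominates every monomial dividing a power of it in support, if the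
latter is squarefree. -/
lemma le_of_support_subset {m R : G.edgeSet →₀ ℕ} (h : R.support ⊆ m.support)
    (hR : ∀ e, R e ≤ 1) : R ≤ m := by
  intro e
  by_cases he : R e = 0
  · omega
  · have := Finsupp.mem_support_iff.1 (h (Finsupp.mem_support_iff.2 he))
    have := hR e
    omega

variable [Fintype V] [DecidableEq V] [DecidableRel G.Adj]

lemma ne_zero_of_vdeg {R B : G.edgeSet →₀ ℕ} (hD : vdeg R = vdeg B) (hne : R ≠ B) : R ≠ 0 := by
  rintro rfl
  rw [vdeg_zero] at hD
  exact hne (vdeg_eq_zero.1 hD.symm).symm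

/-- Induction on the degree of `R`. Common variables cancel, and each split leaves a smaller pair
whose first monomial divides `R`. In the remaining case `R` is squarefree, hence divides `m`, and
`IsolatedMonomial.eq_of_le` applies. -/
lemma IsolatedMonomial.le_of_support_subset (hsharp : SatisfiesSharp G) {m : G.edgeSet →₀ ℕ}
    (hm : IsolatedMonomial m) {R B : G.edgeSet →₀ ℕ} (hD : vdeg R = vdeg B) (hne : R ≠ B)
    (hs : R.support ⊆ m.support) : m ≤ R := by
  induction hn : R.degree using Nat.strong_induction_on generalizing R B with
  | _ n ih =>
    by_cases hdis : ∀ e, R e = 0 ∨ B e = 0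
    · rcases circlePair_or_split hsharp hD (ne_zero_of_vdeg hD hne) hdis with h | h | h
      · exact (hm.eq_of_le (ToricGraph.le_of_support_subset hs
          fun e => by have := h.add_le_one e; omega) hD hne).ge
      · obtain ⟨R₁, R₂, B₁, B₂, rfl, rfl, h1, h2, h3, h4, h5⟩ := h
        have hle : R₁ ≤ R₁ + R₂ := by simp
        exact (ih _ (hn ▸ degree_lt_of_add h3) h1
          (by simpa using ne_of_disjoint (C := 0) h4 hdis)
          ((support_subset_of_le hle).trans hs) rfl).trans hle
      · obtain ⟨z, u, h, R₁, R₂, B₁, B₂, rfl, rfl, h1, h2, h3, h4, -⟩ := h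
        have hle : R₁ ≤ R₁ + R₂ := by simp
        exact (ih _ (hn ▸ degree_lt_of_add h3) h1 (ne_of_disjoint h4 hdis)
          ((support_subset_of_le hle).trans hs) rfl).trans hle
    · push Not at hdis
      obtain ⟨e, hR, hB⟩ := hdis
      obtain ⟨g, R', B', hg, rfl, rfl⟩ := exists_common_edge hR hB
      have hle : R' ≤ g + R' := by simp
      refine (ih R'.degree ?_ (B := B') ?_ ?_ ((support_subset_of_le hle).trans hs) rfl).trans hle
      · rw [← hn, map_add, hg]; omega
      · simpa using hD
      · rintro rfl; exact hne rfl

/-- The same descent, now on both sides at once; it ends with `R = m` and `B = m'`. A chord split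
does not yield a smaller pair with both supports controlled, and has to be excluded. -/
lemma IsolatedMonomial.vdeg_eq_of_support_subset (hsharp : SatisfiesSharp G)
    {m m' : G.edgeSet →₀ ℕ} (hm : IsolatedMonomial m) (hm' : IsolatedMonomial m')
    {R B : G.edgeSet →₀ ℕ} (hD : vdeg R = vdeg B) (hne : R ≠ B)
    (hs : R.support ⊆ m.support) (hs' : B.support ⊆ m'.support) : vdeg m = vdeg m' := by
  induction hn : R.degree using Nat.strong_induction_on generalizing R B with
  | _ n ih =>
    by_cases hdis : ∀ e, R e = 0 ∨ B e = 0
    · rcases circlePair_or_split hsharp hD (ne_zero_of_vdeg hD hne) hdis with h | h | h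
      · have h1 := hm.eq_of_le (ToricGraph.le_of_support_subset hs
          fun e => by have := h.add_le_one e; omega) hD hne
        have h2 := hm'.eq_of_le (ToricGraph.le_of_support_subset hs'
          fun e => by have := h.add_le_one e; omega) hD.symm hne.symm
        rw [← h1, ← h2, hD]
      · obtain ⟨R₁, R₂, B₁, B₂, rfl, rfl, h1, h2, h3, h4, h5⟩ := h
        have hle : R₁ ≤ R₁ + R₂ := by simp
        have hle' : B₁ ≤ B₁ + B₂ := by simp
        exact ih _ (hn ▸ degree_lt_of_add h3) h1
          (by simpa using ne_of_disjoint (C := 0) h4 hdis)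
          ((support_subset_of_le hle).trans hs) ((support_subset_of_le hle').trans hs') rfl
      · obtain ⟨z, u, h, R₁, R₂, B₁, B₂, rfl, rfl, h1, h2, h3, h4, h5⟩ := h
        have hle : R₁ ≤ R₁ + R₂ := by simp
        have hle' : B₂ ≤ B₁ + B₂ := by simp
        have hl1 := hm.le_of_support_subset hsharp h1 (ne_of_disjoint h4 hdis)
          ((support_subset_of_le hle).trans hs)
        have hl2 := hm'.le_of_support_subset hsharp h2.symm
          (ne_of_disjoint (R₁ := B₂) (R₂ := B₁) (B₂ := R₁) h3
            fun e => by rw [add_comm B₂, add_comm R₂]; exact (hdis e).symm)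
          ((support_subset_of_le hle').trans hs')
        have hle2 : R₂ ≤ R₁ + R₂ := by simp
        have hle2' : B₁ ≤ B₁ + B₂ := by simp
        -- Here `m` divides `R₁` and `m'` divides `B₂`, so `R₁` involves all variables of `m` and
        -- `B₂` all those of `m'`. This contradicts the non-inclusion clause of `ChordSplit`.
        rcases h5 with h5 | h5
        · exact absurd (((support_subset_of_le hle2).trans hs).trans (support_subset_of_le hl1)) h5
        · exact absurd (((support_subset_of_le hle2').trans hs').trans
            (support_subset_of_le hl2)) h5
    · push Not at hdis
      obtain ⟨e, hR, hB⟩ := hdis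
      obtain ⟨g, R', B', hg, rfl, rfl⟩ := exists_common_edge hR hB
      have hle : R' ≤ g + R' := by simp
      have hle' : B' ≤ g + B' := by simp
      refine ih R'.degree ?_ (B := B') ?_ ?_ ((support_subset_of_le hle).trans hs)
        ((support_subset_of_le hle').trans hs') rfl
      · rw [← hn, map_add, hg]; omega
      · simpa using hD
      · rintro rfl; exact hne rfl

/-- An isolated monomial is determined by its support. -/
lemma IsolatedMonomial.eq_of_support_eq {m m' : G.edgeSet →₀ ℕ} (hm : IsolatedMonomial m)
    (hm' : IsolatedMonomial m') (h : m.support = m'.support) : m = m' :=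
  le_antisymm (ToricGraph.le_of_support_subset h.le hm.squarefree)
    (ToricGraph.le_of_support_subset h.ge hm'.squarefree)

end Isolated

end ToricGraph

namespace ToricGraph

/-! ### Fibres with three pairwise unlinked monomials -/

section ThreeMonomials

variable {V : Type*} {G : SimpleGraph V}

lemma edgeExp_le_iff {z u : V} (h : G.Adj z u) (Q : G.edgeSet →₀ ℕ) :
    edgeExp h ≤ Q ↔ Q ⟨s(z, u), h⟩ ≠ 0 :=
  Finsupp.single_le_iff.trans Nat.one_le_iff_ne_zero

lemma length_eq_one_of_walkMinus {a b : V} {p : G.Walk a b} (hne : a ≠ b) (h : walkMinus p = 0) :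
    p.length = 1 := by
  have := length_pos_of_ne p hne
  by_contra h1
  exact walkMinus_ne_zero (p := p) (by omega) h

lemma exists_eq_cons_nil {a b : V} {p : G.Walk a b} (h : p.length = 1) :
    ∃ hab : G.Adj a b, p = .cons hab .nil := by
  cases p with
  | nil => simp at h
  | cons hab p =>
    cases p with
    | nil => exact ⟨hab, rfl⟩
    | cons => simp at h

variable [Fintype V] [DecidableEq V] [DecidableRel G.Adj]

/-- The two monomials of an even closed walk and a third monomial of the same degree are pairwise
not linked. -/
structure UnlinkedTriple {a : V} (w : G.Walk a a) (Q : G.edgeSet →₀ ℕ) : Prop where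
  even : Even w.length
  vdeg_eq : vdeg Q = vdeg (walkPlus w)
  plus_minus : ¬ Linked (walkPlus w) (walkMinus w)
  plus : ¬ Linked (walkPlus w) Q
  minus : ¬ Linked (walkMinus w) Q

lemma UnlinkedTriple.altEq {a b : V} {w : G.Walk a a} {w' : G.Walk b b} {Q : G.edgeSet →₀ ℕ}
    (h : UnlinkedTriple w Q) (hw : AltEq w w') : UnlinkedTriple w' Q := by
  have he := h.even
  have hl := hw.length_eq
  obtain ⟨h1, h2, h3, h4, h5⟩ := h
  rcases hw with ⟨hp, hm⟩ | ⟨hp, hm⟩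
  · exact ⟨hl ▸ he, hp ▸ h2, hp ▸ hm ▸ h3, hp ▸ h4, hm ▸ h5⟩
  · refine ⟨hl ▸ he, ?_, ?_, hm ▸ h5, hp ▸ h4⟩
    · rw [h2, vdeg_walk_closed he, hm]
    · rw [← hp, ← hm]; exact fun h => h3 h.symm

lemma UnlinkedTriple.rotate {a b : V} {p : G.Walk a b} {q : G.Walk b a} {Q : G.edgeSet →₀ ℕ}
    (h : UnlinkedTriple (p.append q) Q) : UnlinkedTriple (q.append p) Q :=
  h.altEq (AltEq.rotate p q (by simpa using h.even))

lemma UnlinkedTriple.notMem_edges {a z u : V} {w : G.Walk a a} {Q : G.edgeSet →₀ ℕ}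
    (hw : UnlinkedTriple w Q) (h : G.Adj z u) (hQ : edgeExp h ≤ Q) : s(z, u) ∉ w.edges := by
  intro hmem
  rw [edgeExp_le_iff] at hQ
  rcases (mem_edges_iff w ⟨s(z, u), h⟩).1 hmem with h1 | h1
  · exact hw.plus (Linked.of_common hw.vdeg_eq.symm h1 hQ)
  · exact hw.minus (Linked.of_common (by rw [hw.vdeg_eq, vdeg_walk_closed hw.even]) h1 hQ)

/-- An edge of `Q` cutting the walk into odd parts would link its two monomials; parts of length one
are excluded since no edge of `Q` lies on the walk. -/
lemma UnlinkedTriple.even_left {z u : V} {s : G.Walk z u} {t : G.Walk u z} {Q : G.edgeSet →₀ ℕ}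
    (hw : UnlinkedTriple (s.append t) Q) (h : G.Adj z u) (hQ : edgeExp h ≤ Q) :
    Even s.length := by
  by_contra hs
  have ht : ¬ Even t.length := by
    have := hw.even
    rw [SimpleGraph.Walk.length_append, Nat.even_add] at this
    tauto
  have hn := hw.notMem_edges h hQ
  rw [SimpleGraph.Walk.edges_append, List.mem_append] at hn
  have hs1 : s.length ≠ 1 := fun h1 => hn (Or.inl (edge_mem_of_length_one s h1))
  have ht1 : t.length ≠ 1 := fun h1 => hn (Or.inr (by
    rw [Sym2.eq_swap]; exact edge_mem_of_length_one t h1))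
  have ls := length_pos_of_ne s h.ne
  have lt := length_pos_of_ne t h.ne.symm
  exact hw.plus_minus (linked_of_odd_chord s t hs ht (by omega) (by omega) h)

lemma UnlinkedTriple.mem_support {a u : V} {w : G.Walk a a} {Q : G.edgeSet →₀ ℕ}
    (hw : UnlinkedTriple w Q) (hu : vdeg Q u ≠ 0) : u ∈ w.support := by
  rw [hw.vdeg_eq, vdeg_closed_count hw.even] at hu
  exact List.mem_of_mem_tail (List.count_pos_iff.1 (Nat.pos_of_ne_zero hu))

lemma UnlinkedTriple.vdeg_ne_zero {a u : V} {w : G.Walk a a} {Q : G.edgeSet →₀ ℕ}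
    (hw : UnlinkedTriple w Q) (hu : u ∈ w.support.tail) : vdeg Q u ≠ 0 := by
  rw [hw.vdeg_eq, vdeg_closed_count hw.even]
  exact (List.count_pos_iff.2 hu).ne'

/-- Two odd cycles with a common vertex do not give two of three pairwise unlinked monomials. -/
lemma not_unlinkedTriple_of_odd {x : V} {c q : G.Walk x x} {Q : G.edgeSet →₀ ℕ}
    (hc : c.IsCycle) (hco : ¬ Even c.length) (hqo : ¬ Even q.length) :
    ¬ UnlinkedTriple (c.append q) Q := by
  intro hw
  -- By `even_left`, an edge of `Q` from `x` to a vertex of `c` would cut `c` into two even arcs,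
  -- while `c` is odd.
  have key : ∀ (c q : G.Walk x x), ¬ Even c.length → ∀ {z : V} (h : G.Adj x z), edgeExp h ≤ Q →
      z ∈ c.support → ¬ UnlinkedTriple (c.append q) Q := by
    intro c q hc z h hQ hz hw
    obtain ⟨a₁, a₂, rfl⟩ := SimpleGraph.Walk.mem_support_iff_exists_append.1 hz
    have hw' := hw
    rw [← SimpleGraph.Walk.append_assoc] at hw
    have h1 := hw.even_left h hQ
    have hr := hw.rotate
    rw [← SimpleGraph.Walk.append_assoc] at hr
    have h2 := hr.even_left h.symm (by rwa [edgeExp_symm h])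
    rw [SimpleGraph.Walk.length_append, Nat.even_add] at hc
    tauto
  obtain ⟨z, h, hQ, hz⟩ := exists_edge_of_vdeg (hw.vdeg_ne_zero (u := x)
    (SimpleGraph.Walk.end_mem_tail_support (by
      rw [SimpleGraph.Walk.nil_append_iff]; exact fun h => hc.not_nil h.1)))
  have hz' := hw.mem_support hz
  rw [SimpleGraph.Walk.mem_support_append_iff] at hz'
  rcases hz' with hz' | hz'
  · exact key c q hco h hQ hz' hw
  · exact key q c hqo h hQ hz' hw.rotate

lemma eq_edgeExp_of_vdeg {a b : V} (h : G.Adj a b) {X : G.edgeSet →₀ ℕ}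
    (hX : vdeg X = Pi.single a 1 + Pi.single b 1) : X = edgeExp h := by
  have h1 : vdeg X a ≠ 0 := by rw [hX]; simp
  obtain ⟨u, hu, hle, hu0⟩ := exists_edge_of_vdeg h1
  have hub : u = b := by
    rw [hX] at hu0
    by_contra hub
    simp [hu.ne.symm, hub] at hu0
  subst hub
  exact (eq_of_le_of_vdeg_eq hle (by rw [hX, vdeg_edgeExp])).symm

/-- The monomials whose degree is one at four pairwise adjacent vertices. -/
lemma eq_of_vdeg_four {a b c d : V} (hab : G.Adj a b) (hcd : G.Adj c d) (hac : G.Adj a c)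
    (hbd : G.Adj b d) (had : G.Adj a d) (hbc : G.Adj b c) {X : G.edgeSet →₀ ℕ}
    (hX : vdeg X = Pi.single a 1 + Pi.single b 1 + Pi.single c 1 + Pi.single d 1) :
    X = edgeExp hab + edgeExp hcd ∨ X = edgeExp hac + edgeExp hbd ∨
      X = edgeExp had + edgeExp hbc := by
  have h1 : vdeg X a ≠ 0 := by rw [hX]; simp
  obtain ⟨u, hu, hle, hu0⟩ := exists_edge_of_vdeg h1
  have hcases : u = b ∨ u = c ∨ u = d := by
    by_contra hne
    push Not at hne
    rw [hX] at hu0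
    simp [hu.ne.symm, hne.1, hne.2.1, hne.2.2] at hu0
  obtain ⟨X', rfl⟩ := le_iff_exists_add.1 hle
  rw [vdeg_add, vdeg_edgeExp] at hX
  rcases hcases with rfl | rfl | rfl
  · rw [eq_edgeExp_of_vdeg hcd (add_left_cancel (hX.trans (by abel)))]
    exact Or.inl rfl
  · rw [eq_edgeExp_of_vdeg hbd (add_left_cancel (hX.trans (by abel)))]
    exact Or.inr (Or.inl rfl)
  · rw [eq_edgeExp_of_vdeg hbc (add_left_cancel (hX.trans (by abel)))]
    exact Or.inr (Or.inr rfl)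

/-- The arcs `m`, `C`, `D` are odd. The monomial made of their `walkMinus` parts and the two chords
lies in the fibre and shares a chord with `Q`, so a nonzero `walkMinus` of an arc would link `Q` to
a monomial of the walk. All arcs are thus single edges: the graph contains a complete graph on four
vertices, and the fibre consists of its three perfect matchings. -/
lemma UnlinkedTriple.eq_of_crossing {s y t y' : V} {hsy : G.Adj s y} {m : G.Walk y t}
    {C : G.Walk t y'} {D : G.Walk y' s} {Q : G.edgeSet →₀ ℕ}
    (hw : UnlinkedTriple ((SimpleGraph.Walk.cons hsy m).append (C.append D)) Q)
    (hst : G.Adj s t) (hyy : G.Adj y y') (hQ1 : edgeExp hst ≤ Q) (hQ2 : edgeExp hyy ≤ Q)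
    (hyt : y ≠ t) (hys : y' ≠ s) (hty : t ≠ y')
    {X : G.edgeSet →₀ ℕ} (hX : vdeg X = vdeg Q) :
    X = walkPlus ((SimpleGraph.Walk.cons hsy m).append (C.append D)) ∨
      X = walkMinus ((SimpleGraph.Walk.cons hsy m).append (C.append D)) ∨ X = Q := by
  have h1 := hw.even_left hst hQ1
  rw [SimpleGraph.Walk.length_cons, Nat.even_add_one] at h1
  have hC : ¬ Even C.length := by
    have hw' := hw
    rw [SimpleGraph.Walk.cons_append, ← SimpleGraph.Walk.cons_nil_append] at hw'
    have hr := hw'.rotate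
    rw [SimpleGraph.Walk.append_assoc, ← SimpleGraph.Walk.append_assoc (m.append C)] at hr
    have h2 := hr.even_left hyy hQ2
    rw [SimpleGraph.Walk.length_append, Nat.even_add] at h2
    tauto
  have hD : ¬ Even D.length := by
    have h2 := hw.even
    simp only [SimpleGraph.Walk.length_append, SimpleGraph.Walk.length_cons, Nat.even_add,
      Nat.even_add_one] at h2
    tauto
  have hPw : walkPlus ((SimpleGraph.Walk.cons hsy m).append (C.append D)) =
      edgeExp hsy + walkMinus m + (walkPlus C + walkMinus D) := by
    rw [walkPlus_append, walkPlus_append, walkPlus_cons, SimpleGraph.Walk.length_cons, if_neg hC,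
      if_pos (Nat.even_add_one.2 h1)]
  have hMw : walkMinus ((SimpleGraph.Walk.cons hsy m).append (C.append D)) =
      walkPlus m + (walkMinus C + walkPlus D) := by
    rw [walkMinus_append, walkMinus_append, walkMinus_cons, SimpleGraph.Walk.length_cons, if_neg hC,
      if_pos (Nat.even_add_one.2 h1)]
  have hDC := vdeg_walk_odd hC
  have hDw := vdeg_walk_closed hw.even
  have hp := hw.plus
  have hm := hw.minus
  have hv := hw.vdeg_eq
  rw [hPw] at hp
  rw [hMw] at hm
  rw [hPw, hMw] at hDw
  rw [hPw] at hv ⊢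
  rw [hMw]
  have hmid : vdeg (walkMinus C + edgeExp hst + edgeExp hyy + walkMinus m + walkMinus D) =
      vdeg (edgeExp hsy + walkMinus m + (walkPlus C + walkMinus D)) := by
    simp only [vdeg_add, vdeg_edgeExp, hDC]
    abel
  have hmidQ : Linked (walkMinus C + edgeExp hst + edgeExp hyy + walkMinus m + walkMinus D) Q := by
    refine Linked.of_le (hmid.trans hv.symm) (edgeExp_ne_zero hst) ?_ hQ1
    exact le_iff_exists_add.2 ⟨walkMinus C + edgeExp hyy + walkMinus m + walkMinus D, by abel⟩
  have hm0 : walkMinus m = 0 := by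
    by_contra h0
    refine hp ((Linked.of_le hmid.symm h0 ?_ ?_).trans hmidQ)
    · exact le_iff_exists_add.2 ⟨edgeExp hsy + (walkPlus C + walkMinus D), by abel⟩
    · exact le_iff_exists_add.2
        ⟨walkMinus C + edgeExp hst + edgeExp hyy + walkMinus D, by abel⟩
  have hD0 : walkMinus D = 0 := by
    by_contra h0
    refine hp ((Linked.of_le hmid.symm h0 ?_ ?_).trans hmidQ)
    · exact le_iff_exists_add.2 ⟨edgeExp hsy + walkMinus m + walkPlus C, by abel⟩
    · exact le_iff_exists_add.2
        ⟨walkMinus C + edgeExp hst + edgeExp hyy + walkMinus m, by abel⟩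
  have hC0 : walkMinus C = 0 := by
    by_contra h0
    refine hm ((Linked.of_le (hDw.symm.trans hmid.symm) h0 ?_ ?_).trans hmidQ)
    · exact le_iff_exists_add.2 ⟨walkPlus m + walkPlus D, by abel⟩
    · exact le_iff_exists_add.2
        ⟨edgeExp hst + edgeExp hyy + walkMinus m + walkMinus D, by abel⟩
  obtain ⟨hym, rfl⟩ := exists_eq_cons_nil (length_eq_one_of_walkMinus hyt hm0)
  obtain ⟨htC, rfl⟩ := exists_eq_cons_nil (length_eq_one_of_walkMinus hty hC0)
  obtain ⟨hDs, rfl⟩ := exists_eq_cons_nil (length_eq_one_of_walkMinus hys hD0)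
  simp only [walkPlus_cons, walkMinus_cons, walkPlus_nil, walkMinus_nil, add_zero, zero_add]
    at hv ⊢
  have hQ : Q = edgeExp hst + edgeExp hyy := by
    refine (eq_of_le_of_vdeg_eq ?_ ?_).symm
    · intro e
      have e1 := hQ1 e
      have e2 := hQ2 e
      rw [edgeExp_apply] at e1 e2
      rw [Finsupp.add_apply, edgeExp_apply, edgeExp_apply]
      split_ifs at e1 e2 ⊢ with e3 e4
      · exfalso
        have : s(s, t) = s(y, y') := e3.symm.trans e4
        rcases Sym2.eq_iff.1 this with h | h
        · exact hsy.ne h.1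
        · exact hyt h.2.symm
      all_goals omega
    · rw [hv]
      simp only [vdeg_add, vdeg_edgeExp]
      abel
  have hXv : vdeg X = Pi.single s 1 + Pi.single y 1 + Pi.single t 1 + Pi.single y' 1 := by
    rw [hX, hv, vdeg_add, vdeg_edgeExp, vdeg_edgeExp]
    abel
  rcases eq_of_vdeg_four hsy htC hst hyy hDs.symm hym hXv with h | h | h
  · exact Or.inl h
  · exact Or.inr (Or.inr (h.trans hQ.symm))
  · refine Or.inr (Or.inl (h.trans ?_))
    rw [edgeExp_symm hDs, add_comm]

/-- Choose an edge `st` of `Q` and a presentation of the walk with the shortest arc from `s` to `t`.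
The edge of `Q` at the next vertex `y` cannot end inside this arc, by minimality, nor at `s` or `t`;
so it crosses `st`. -/
lemma UnlinkedTriple.eq_of_cycle {a : V} {w : G.Walk a a} {Q : G.edgeSet →₀ ℕ}
    (hw : UnlinkedTriple w Q) (hl : 0 < w.length) {X : G.edgeSet →₀ ℕ} (hX : vdeg X = vdeg Q) :
    X = walkPlus w ∨ X = walkMinus w ∨ X = Q := by
  classical
  have hex : ∃ n, ∃ (s t : V) (w₁ : G.Walk s t) (w₂ : G.Walk t s) (h : G.Adj s t),
      w₁.length = n ∧ edgeExp h ≤ Q ∧ AltEq w (w₁.append w₂) := by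
    obtain ⟨u, h, hle, hu⟩ := exists_edge_of_vdeg (hw.vdeg_ne_zero (u := a)
      (SimpleGraph.Walk.end_mem_tail_support (SimpleGraph.Walk.not_nil_iff_lt_length.2 hl)))
    obtain ⟨w₁, w₂, rfl⟩ := SimpleGraph.Walk.mem_support_iff_exists_append.1 (hw.mem_support hu)
    exact ⟨_, a, u, w₁, w₂, h, rfl, hle, Or.inl ⟨rfl, rfl⟩⟩
  obtain ⟨s, t, w₁, w₂, hst, hn, hle, hE⟩ := Nat.find_spec hex
  have hmin : ∀ (s t : V) (v₁ : G.Walk s t) (v₂ : G.Walk t s) (h : G.Adj s t), edgeExp h ≤ Q →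
      AltEq w (v₁.append v₂) → w₁.length ≤ v₁.length := by
    intro s t v₁ v₂ h h1 h2
    rw [hn]
    exact Nat.find_min' _ ⟨s, t, v₁, v₂, h, rfl, h1, h2⟩
  clear hn
  have hw' := hw.altEq hE
  cases w₁ with
  | nil => exact absurd hst G.irrefl
  | @cons _ y _ hsy m =>
    have hr : AltEq ((SimpleGraph.Walk.cons hsy m).append w₂)
        (m.append (w₂.append (.cons hsy .nil))) := by
      have h0 := hw'.even
      have := AltEq.rotate (.cons hsy .nil) (m.append w₂) (by
        simp only [SimpleGraph.Walk.length_append, SimpleGraph.Walk.length_cons,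
          SimpleGraph.Walk.length_nil] at h0 ⊢
        rwa [show 0 + 1 + (m.length + w₂.length) = m.length + 1 + w₂.length by ring])
      rwa [SimpleGraph.Walk.cons_nil_append, ← SimpleGraph.Walk.append_assoc] at this
    have hwr := hw'.altEq hr
    have h1 := hw'.even_left hst hle
    rw [SimpleGraph.Walk.length_cons, Nat.even_add_one] at h1
    have hyt : y ≠ t := by
      rintro rfl
      exact hw'.notMem_edges hst hle (by simp)
    obtain ⟨y', hyy, hQ2, hy'⟩ := exists_edge_of_vdeg (hw'.vdeg_ne_zero (u := y) (by simp))
    have hys : y' ≠ s := by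
      rintro rfl
      refine hw'.notMem_edges hyy hQ2 ?_
      rw [Sym2.eq_swap]
      simp
    have hty : t ≠ y' := by
      rintro rfl
      exact h1 (hwr.even_left hyy hQ2)
    have hy'w := hw'.mem_support hy'
    rw [SimpleGraph.Walk.mem_support_append_iff, SimpleGraph.Walk.support_cons,
      List.mem_cons] at hy'w
    rcases hy'w with (h2 | h2) | h2
    · exact absurd h2 hys
    · exfalso
      obtain ⟨m₁, m₂, rfl⟩ := SimpleGraph.Walk.mem_support_iff_exists_append.1 h2
      rw [← SimpleGraph.Walk.append_assoc] at hr
      have := hmin y y' m₁ _ hyy hQ2 (hE.trans hr)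
      rw [SimpleGraph.Walk.length_cons, SimpleGraph.Walk.length_append] at this
      omega
    · obtain ⟨C, D, rfl⟩ := SimpleGraph.Walk.mem_support_iff_exists_append.1 h2
      have := hw'.eq_of_crossing hst hyy hle hQ2 hyt hys hty hX
      rcases hE with ⟨hp, hm⟩ | ⟨hp, hm⟩ <;> rw [hp, hm] <;> tauto

/-- Three monomials of the same degree which are pairwise not linked are the only monomials of
this degree. -/
lemma eq_of_unlinked (hsharp : SatisfiesSharp G) {M N Q X : G.edgeSet →₀ ℕ}
    (hMN : vdeg M = vdeg N) (hMQ : vdeg M = vdeg Q) (h1 : ¬ Linked M N) (h2 : ¬ Linked M Q)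
    (h3 : ¬ Linked N Q) (hX : vdeg X = vdeg M) : X = M ∨ X = N ∨ X = Q := by
  rcases circlePair_of_not_linked hsharp hMN h1 with
    ⟨a, w, hc, he, hw⟩ | ⟨x, c, q, hc, -, hco, hqo, -, hw⟩
  · have hl : 0 < w.length := by have := hc.three_le_length; omega
    rcases hw with ⟨rfl, rfl⟩ | ⟨rfl, rfl⟩
    · exact UnlinkedTriple.eq_of_cycle ⟨he, hMQ.symm, h1, h2, h3⟩ hl (hX.trans hMQ)
    · have := UnlinkedTriple.eq_of_cycle ⟨he, hMQ.symm.trans hMN, fun h => h1 h.symm, h3, h2⟩ hl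
        (hX.trans hMQ)
      tauto
  · exfalso
    have he : Even (c.append q).length := by
      rw [SimpleGraph.Walk.length_append, Nat.even_add]; tauto
    rcases hw with ⟨rfl, rfl⟩ | ⟨rfl, rfl⟩
    · exact not_unlinkedTriple_of_odd hc hco hqo ⟨he, hMQ.symm, h1, h2, h3⟩
    · exact not_unlinkedTriple_of_odd hc hco hqo
        ⟨he, hMQ.symm.trans hMN, fun h => h1 h.symm, h3, h2⟩

end ThreeMonomials

end ToricGraph

namespace ToricGraph

/-! ### Binomial ideals, radicals and least systems -/

section Binomials

open MvPolynomial

variable {σ K : Type*} [Field K]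

lemma sub_monomial_ne_zero {u v : σ →₀ ℕ} (h : u ≠ v) :
    (monomial u 1 - monomial v 1 : MvPolynomial σ K) ≠ 0 := by
  rw [sub_ne_zero]
  intro h'
  exact h (monomial_left_injective one_ne_zero h')

lemma mem_support_sub_monomial {u v m : σ →₀ ℕ} (h : u ≠ v) :
    m ∈ (monomial u 1 - monomial v 1 : MvPolynomial σ K).support ↔ m = u ∨ m = v := by
  classical
  rw [mem_support_iff, coeff_sub, coeff_monomial, coeff_monomial]
  by_cases h1 : u = m
  · subst h1; simp [h.symm]
  · by_cases h2 : v = m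
    · subst h2; simp [h]
    · simp [h1, h2, eq_comm]

/-- A homogeneous element of an ideal spanned by homogeneous polynomials is generated by those of
at most its degree. -/
lemma mem_span_of_isHomogeneous {S : Set (MvPolynomial σ K)}
    (hS : ∀ f ∈ S, ∃ k, f.IsHomogeneous k) {p : MvPolynomial σ K} {n : ℕ} (hp : p.IsHomogeneous n)
    (hmem : p ∈ Ideal.span S) :
    p ∈ Ideal.span {f | f ∈ S ∧ ∃ k ≤ n, f.IsHomogeneous k} := by
  rw [← homogeneousComponent_eq_self hp]
  clear hp
  obtain ⟨c, hc, rfl⟩ := Submodule.mem_span_set.1 hmem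
  rw [Finsupp.sum, map_sum]
  refine Submodule.sum_mem _ fun f hf => ?_
  have hfS := hc hf
  obtain ⟨k, hk⟩ := hS f hfS
  rw [smul_eq_mul, (c f).as_sum, Finset.sum_mul, map_sum]
  refine Submodule.sum_mem _ fun u _ => ?_
  have hhom : (monomial u (coeff u (c f)) * f).IsHomogeneous (u.degree + k) :=
    (isHomogeneous_monomial _ rfl).mul hk
  rw [homogeneousComponent_of_mem hhom]
  split_ifs with hn
  · exact Ideal.mul_mem_left _ _ (Ideal.subset_span ⟨hfS, k, by omega, hk⟩)
  · exact Submodule.zero_mem _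

lemma eval_indicator_monomial (m u : σ →₀ ℕ) [DecidableEq σ] :
    eval (fun e => if e ∈ m.support then (1 : K) else 0) (monomial u 1) =
      if u.support ⊆ m.support then 1 else 0 := by
  rw [eval_monomial, one_mul, Finsupp.prod]
  split_ifs with h
  · exact Finset.prod_eq_one fun e he => by rw [if_pos (h he), one_pow]
  · obtain ⟨e, he, hem⟩ := Finset.not_subset.1 h
    refine Finset.prod_eq_zero he ?_
    rw [if_neg hem, zero_pow (Finsupp.mem_support_iff.1 he)]

/-- If some system of binomials has the same radical as the ideal, then for every binomial of the
ideal one of the binomials of the system involves a variable set contained in that of the first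
monomial. -/
lemma exists_support_subset {ι : Type*} {I : Ideal (MvPolynomial σ K)} {u v : ι → σ →₀ ℕ}
    (hI : I.radical = (Ideal.span (Set.range fun i =>
      (monomial (u i) 1 - monomial (v i) 1 : MvPolynomial σ K))).radical) {m n : σ →₀ ℕ}
    (hmn : (monomial m 1 - monomial n 1 : MvPolynomial σ K) ∈ I)
    (hn : ¬ n.support ⊆ m.support) :
    ∃ i, (u i).support ⊆ m.support ∨ (v i).support ⊆ m.support := by
  classical
  by_contra! hne
  -- At the indicator point of the support of `m` a monomial takes the value one if its support lies
  -- there, and zero otherwise. All binomials of the system would vanish at this point while the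
  -- given element of `I` does not.
  set φ := eval (fun e => if e ∈ m.support then (1 : K) else 0) with hφ
  have h1 : Ideal.span (Set.range fun i =>
      (monomial (u i) 1 - monomial (v i) 1 : MvPolynomial σ K)) ≤ RingHom.ker φ := by
    rw [Ideal.span_le]
    rintro _ ⟨i, rfl⟩
    simp only [SetLike.mem_coe, RingHom.mem_ker, map_sub]
    rw [hφ, eval_indicator_monomial, eval_indicator_monomial, if_neg (hne i).1, if_neg (hne i).2,
      sub_zero]
  have h2 : (monomial m 1 - monomial n 1 : MvPolynomial σ K) ∈ RingHom.ker φ := by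
    have h3 := Ideal.radical_mono h1 (hI ▸ Ideal.le_radical hmn)
    rwa [(RingHom.ker_isPrime φ).radical] at h3
  rw [RingHom.mem_ker, map_sub, hφ, eval_indicator_monomial, eval_indicator_monomial,
    if_pos (Finset.Subset.refl _), if_neg hn, sub_zero] at h2
  exact one_ne_zero h2

lemma mk_eq_mk_of_mem {J : Ideal (MvPolynomial σ K)} {u v : σ →₀ ℕ}
    (h : (monomial u 1 - monomial v 1 : MvPolynomial σ K) ∈ J) :
    Ideal.Quotient.mk J (monomial u 1) = Ideal.Quotient.mk J (monomial v 1) :=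
  Ideal.Quotient.eq.2 h

lemma exists_finset_isBinomialSystem [Finite σ] {I : Ideal (MvPolynomial σ K)}
    (hI : Ideal.span {f | IsBinomial f ∧ f ∈ I} = I) :
    ∃ S : Finset (MvPolynomial σ K), IsBinomialSystem I (S : Set (MvPolynomial σ K)) := by
  have hfg : (Submodule.span (MvPolynomial σ K) {f | IsBinomial f ∧ f ∈ I}).FG :=
    IsNoetherian.noetherian _
  obtain ⟨S, hS, hspan⟩ := (Submodule.fg_span_iff_fg_span_finset_subset _).1 hfg
  refine ⟨S, fun f hf => (hS hf).1, ?_⟩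
  rw [← hI]
  exact hspan.symm

lemma notMem_span_of_card_eq_mu {I : Ideal (MvPolynomial σ K)} {S : Finset (MvPolynomial σ K)}
    (hS : IsBinomialSystem I (S : Set (MvPolynomial σ K))) (hcard : S.card = mu I)
    {f : MvPolynomial σ K} (hf : f ∈ S) :
    f ∉ Ideal.span ((S : Set (MvPolynomial σ K)) \ {f}) := by
  classical
  intro hmem
  have hsys : IsBinomialSystem I ((S.erase f : Finset _) : Set (MvPolynomial σ K)) := by
    refine ⟨fun g hg => hS.1 g (Finset.mem_of_mem_erase hg), ?_⟩
    rw [Finset.coe_erase]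
    refine le_antisymm ?_ ?_
    · rw [← hS.2]
      exact Ideal.span_mono Set.sdiff_subset
    · conv_lhs => rw [← hS.2]
      rw [Ideal.span_le]
      intro g hg
      by_cases hgf : g = f
      · subst hgf; exact hmem
      · exact Ideal.subset_span ⟨hg, hgf⟩
  have h1 : mu I ≤ (S.erase f).card := Nat.sInf_le ⟨S.erase f, hsys, rfl⟩
  have h2 := Finset.card_erase_lt_of_mem hf
  omega

lemma isMinimalBinomial_of_card_eq_mu {I : Ideal (MvPolynomial σ K)}
    {S : Finset (MvPolynomial σ K)}
    (hS : IsBinomialSystem I (S : Set (MvPolynomial σ K))) (hcard : S.card = mu I)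
    {f : MvPolynomial σ K} (hf : f ∈ S) : IsMinimalBinomial I f := by
  refine ⟨S, ⟨hS, fun T hT hTS g hg => ?_⟩, hf⟩
  by_contra hgT
  refine notMem_span_of_card_eq_mu hS hcard hg ?_
  have hgI : g ∈ Ideal.span T := by
    rw [hT.2, ← hS.2]
    exact Ideal.subset_span hg
  refine Ideal.span_mono ?_ hgI
  intro h hh
  exact ⟨hTS hh, fun he => hgT (he ▸ hh)⟩

end Binomials

/-! ### The toric ideal of a graph and its fibres -/

section GraphIdeal

open MvPolynomial

variable {V : Type*} {G : SimpleGraph V} [Fintype V] [DecidableEq V] [DecidableRel G.Adj]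
  {K : Type*} [Field K]

/-- The vertex degrees as an additive map to exponent vectors. -/
noncomputable def vdegHom : (G.edgeSet →₀ ℕ) →+ (V →₀ ℕ) where
  toFun m := Finsupp.equivFunOnFinite.symm (vdeg m)
  map_zero' := by ext; simp
  map_add' m n := by ext; simp

/-- One direction maps each edge variable to the product of the variables of its end points; this
kills the generators and records `vdeg`. For the converse, divide by the greatest common divisor `m
⊓ n`. -/
lemma sub_monomial_mem_graphIdeal {m n : G.edgeSet →₀ ℕ} :
    (monomial m 1 - monomial n 1 : MvPolynomial G.edgeSet K) ∈ graphIdeal K G ↔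
      vdeg m = vdeg n := by
  constructor
  · intro h
    let φ : MvPolynomial G.edgeSet K →ₐ[K] MvPolynomial V K :=
      aeval fun e => monomial (vdegHom (Finsupp.single e 1)) 1
    have hφ : ∀ k : G.edgeSet →₀ ℕ, φ (monomial k 1) = monomial (vdegHom k) 1 := by
      intro k
      induction k using Finsupp.induction_linear with
      | zero => simp
      | add f g hf hg =>
        have h1 : (monomial (f + g) 1 : MvPolynomial G.edgeSet K) =
          monomial f 1 * monomial g 1 := by rw [monomial_mul, one_mul]
        rw [h1, map_mul, hf, hg, monomial_mul, one_mul, map_add]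
      | single e i =>
        have h1 : (monomial (Finsupp.single e i) 1 : MvPolynomial G.edgeSet K) = X e ^ i := by
          rw [X_pow_eq_monomial]
        have h2 : Finsupp.single e i = i • Finsupp.single e 1 := by simp
        rw [h1, map_pow, aeval_X, monomial_pow, one_pow, ← map_nsmul, ← h2]
    have hker : graphIdeal K G ≤ RingHom.ker φ.toRingHom := by
      refine Ideal.span_le.2 ?_
      rintro _ ⟨u, hu, rfl⟩
      have hv : vdegHom (posExp u) = vdegHom (negExp u) := by
        ext y
        have h1 := mem_kerZ_iff.1 hu y
        have h2 := sum_sub_eq_vdeg (posExp u) (negExp u) y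
        have h3 : ∀ e : G.edgeSet, ((posExp u e : ℤ) - negExp u e) = u e := by
          intro e
          simp only [posExp, negExp, Finsupp.equivFunOnFinite_symm_apply_apply]
          omega
        simp only [h3, h1] at h2
        change vdeg (posExp u) y = vdeg (negExp u) y
        omega
      change φ (vecBinomial K u) = 0
      rw [vecBinomial, map_sub, hφ, hφ, hv, sub_self]
    have h1 : φ (monomial m 1 - monomial n 1) = 0 := hker h
    rw [map_sub, hφ, hφ, sub_eq_zero] at h1
    have h2 := monomial_left_injective (one_ne_zero (α := K)) h1
    exact Finsupp.equivFunOnFinite.symm.injective h2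
  · intro h
    have hmem : vecBinomial K (fun e => (m e : ℤ) - n e) ∈ graphIdeal K G :=
      Ideal.subset_span ⟨_, sub_mem_kerZ h, rfl⟩
    have heq : (monomial m 1 - monomial n 1 : MvPolynomial G.edgeSet K) =
        monomial (m ⊓ n) 1 * vecBinomial K (fun e => (m e : ℤ) - n e) := by
      rw [vecBinomial, mul_sub, monomial_mul, monomial_mul, one_mul]
      congr 2
      · congr 1
        ext e
        simp only [posExp, Finsupp.add_apply, Finsupp.inf_apply,
          Finsupp.equivFunOnFinite_symm_apply_apply]
        omega
      · congr 1
        ext e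
        simp only [negExp, Finsupp.add_apply, Finsupp.inf_apply,
          Finsupp.equivFunOnFinite_symm_apply_apply]
        omega
    rw [heq]
    exact Ideal.mul_mem_left _ _ hmem

lemma graphIdeal_le {J : Ideal (MvPolynomial G.edgeSet K)}
    (h : ∀ m n : G.edgeSet →₀ ℕ, m ≠ n → vdeg m = vdeg n →
      (monomial m 1 - monomial n 1 : MvPolynomial G.edgeSet K) ∈ J) : graphIdeal K G ≤ J := by
  refine Ideal.span_le.2 ?_
  rintro _ ⟨u, hu, rfl⟩
  have hI : vecBinomial K u ∈ graphIdeal K G := Ideal.subset_span ⟨u, hu, rfl⟩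
  by_cases hne : posExp u = negExp u
  · rw [vecBinomial, hne, sub_self]
    exact J.zero_mem
  · exact h _ _ hne (sub_monomial_mem_graphIdeal.1 hI)

lemma span_binomials_graphIdeal :
    Ideal.span {f | IsBinomial f ∧ f ∈ graphIdeal K G} = graphIdeal K G := by
  refine le_antisymm (Ideal.span_le.2 fun f hf => hf.2) (graphIdeal_le fun m n hne hD => ?_)
  exact Ideal.subset_span ⟨⟨m, n, hne, rfl⟩, sub_monomial_mem_graphIdeal.2 hD⟩

/-- If `m = g + m'` and `n = g + n'`, the binomial of `m` and `n` is a multiple of one of lower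
degree, which cannot involve `m`. Passing through `n`, the binomials of the ideal that avoid `m`
already generate it. -/
lemma disjoint_of_indispensable {m n : G.edgeSet →₀ ℕ}
    (hm : IsIndispensableMonomial (graphIdeal K G) m) (hD : vdeg n = vdeg m) (hne : n ≠ m)
    (e : G.edgeSet) : m e = 0 ∨ n e = 0 := by
  by_contra h
  push Not at h
  obtain ⟨g, m', n', hg, rfl, rfl⟩ := exists_common_edge h.1 h.2
  set S : Set (MvPolynomial G.edgeSet K) :=
    {f | IsBinomial f ∧ f ∈ graphIdeal K G ∧ g + m' ∉ f.support} with hS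
  have hmem : ∀ A B : G.edgeSet →₀ ℕ, vdeg A = vdeg B → A ≠ g + m' → B ≠ g + m' →
      (monomial A 1 - monomial B 1 : MvPolynomial G.edgeSet K) ∈ Ideal.span S := by
    intro A B hAB hA hB
    by_cases hne : A = B
    · rw [hne, sub_self]; exact Submodule.zero_mem _
    · refine Ideal.subset_span ⟨⟨A, B, hne, rfl⟩, sub_monomial_mem_graphIdeal.2 hAB, ?_⟩
      rw [mem_support_sub_monomial hne]
      rintro (h | h)
      · exact hA h.symm
      · exact hB h.symm
  have hD' : vdeg n' = vdeg m' := by simpa using hD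
  have hself : ∀ k : G.edgeSet →₀ ℕ, k.degree = m'.degree → k ≠ g + m' := by
    rintro k hk rfl
    rw [map_add, hg] at hk
    omega
  have hmn : (monomial (g + m') 1 - monomial (g + n') 1 : MvPolynomial G.edgeSet K) ∈
      Ideal.span S := by
    have h1 : ∀ k, (monomial (g + k) 1 : MvPolynomial G.edgeSet K) =
      monomial g 1 * monomial k 1 := fun k => by rw [monomial_mul, one_mul]
    rw [h1, h1, ← mul_sub]
    exact Ideal.mul_mem_left _ _ (hmem m' n' hD'.symm (hself m' rfl)
      (hself n' (degree_eq_of_vdeg_eq hD')))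
  have hsys : IsBinomialSystem (graphIdeal K G) S := by
    refine ⟨fun f hf => hf.1, le_antisymm (Ideal.span_le.2 fun f hf => hf.2.1)
      (graphIdeal_le fun A B hAB hvAB => ?_)⟩
    by_cases hA : A = g + m'
    · subst hA
      have h2 := hmem (g + n') B (hD.trans hvAB) hne hAB.symm
      have h3 := Ideal.add_mem _ hmn h2
      rwa [sub_add_sub_cancel] at h3
    · by_cases hB : B = g + m'
      · subst hB
        have h2 := hmem A (g + n') (hvAB.trans hD.symm) hA hne
        have h3 := Ideal.sub_mem _ h2 hmn
        rwa [sub_sub_sub_cancel_right] at h3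
      · exact hmem A B hvAB hA hB
  obtain ⟨f, hf, hmf⟩ := hm S hsys
  exact hf.2.2 hmf

/-- In each step a common variable factors out, leaving a binomial of the ideal of smaller degree;
by homogeneity it needs only generators of at most that degree. -/
lemma mem_span_of_linked {S : Set (MvPolynomial G.edgeSet K)}
    (hS : IsBinomialSystem (graphIdeal K G) S) {m n : G.edgeSet →₀ ℕ} (h : Linked m n) :
    (monomial m 1 - monomial n 1 : MvPolynomial G.edgeSet K) ∈
      Ideal.span {f | f ∈ S ∧ ∃ k < m.degree, f.IsHomogeneous k} := by
  have hhom : ∀ f ∈ S, ∃ k, f.IsHomogeneous k := by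
    intro f hf
    obtain ⟨u, v, huv, rfl⟩ := hS.1 f hf
    have hI : (monomial u 1 - monomial v 1 : MvPolynomial G.edgeSet K) ∈ graphIdeal K G := by
      rw [← hS.2]; exact Ideal.subset_span hf
    have hd := degree_eq_of_vdeg_eq (sub_monomial_mem_graphIdeal.1 hI)
    exact ⟨u.degree, (isHomogeneous_monomial _ rfl).sub (isHomogeneous_monomial _ hd.symm)⟩
  suffices H : vdeg m = vdeg n ∧ (monomial m 1 - monomial n 1 : MvPolynomial G.edgeSet K) ∈
      Ideal.span {f | f ∈ S ∧ ∃ k < m.degree, f.IsHomogeneous k} from H.2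
  induction h with
  | refl => simp
  | @tail a b _ hab ih =>
    obtain ⟨hD, e, ha, hb⟩ := hab
    refine ⟨ih.1.trans hD, ?_⟩
    rw [← sub_add_sub_cancel _ (monomial a 1)]
    refine Ideal.add_mem _ ih.2 ?_
    have hdeg := degree_eq_of_vdeg_eq ih.1
    obtain ⟨g, a', b', hg, rfl, rfl⟩ := exists_common_edge ha hb
    have h1 : ∀ k, (monomial (g + k) 1 : MvPolynomial G.edgeSet K) =
      monomial g 1 * monomial k 1 := fun k => by rw [monomial_mul, one_mul]
    have hD' : vdeg a' = vdeg b' := by simpa using hD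
    rw [h1, h1, ← mul_sub]
    refine Ideal.mul_mem_left _ _ ?_
    have h2 := mem_span_of_isHomogeneous hhom (n := a'.degree)
      ((isHomogeneous_monomial (1 : K) rfl).sub
        (isHomogeneous_monomial 1 (degree_eq_of_vdeg_eq hD').symm))
      (by rw [hS.2]; exact sub_monomial_mem_graphIdeal.2 hD')
    refine Ideal.span_mono ?_ h2
    rintro f ⟨hf, k, hk, hfk⟩
    rw [map_add, hg] at hdeg
    exact ⟨hf, k, by omega, hfk⟩

lemma mem_span_diff_of_linked {S : Set (MvPolynomial G.edgeSet K)}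
    (hS : IsBinomialSystem (graphIdeal K G) S) {m n u v : G.edgeSet →₀ ℕ} (h : Linked m n)
    (huv : u ≠ v) (hD : vdeg u = vdeg v) (hd : m.degree ≤ u.degree) :
    (monomial m 1 - monomial n 1 : MvPolynomial G.edgeSet K) ∈
      Ideal.span (S \ {monomial u 1 - monomial v 1}) := by
  refine Ideal.span_mono ?_ (mem_span_of_linked hS h)
  rintro f ⟨hf, k, hk, hfk⟩
  refine ⟨hf, ?_⟩
  rintro rfl
  have h1 : (monomial u 1 - monomial v 1 : MvPolynomial G.edgeSet K).IsHomogeneous u.degree :=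
    (isHomogeneous_monomial _ rfl).sub (isHomogeneous_monomial _ (degree_eq_of_vdeg_eq hD).symm)
  have := h1.inj_right hfk (sub_monomial_ne_zero huv)
  omega

/-- By `eq_of_unlinked` the fibre is `{M, N, Q}`, and sharing a variable with `N` or `Q` would be a
link. -/
lemma isolatedMonomial_of_unlinked (hsharp : SatisfiesSharp G) {M N Q : G.edgeSet →₀ ℕ}
    (hMN : vdeg M = vdeg N) (hMQ : vdeg M = vdeg Q) (h1 : ¬ Linked M N) (h2 : ¬ Linked M Q)
    (h3 : ¬ Linked N Q) : IsolatedMonomial M := by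
  refine ⟨fun e => ?_, fun n hn hne e => ?_, N, hMN.symm, ?_⟩
  · have := (circlePair_of_not_linked hsharp hMN h1).add_le_one e
    omega
  · by_contra! he
    have hl : Linked M n := Linked.of_common hn.symm he.1 he.2
    rcases eq_of_unlinked hsharp hMN hMQ h1 h2 h3 hn with rfl | rfl | rfl
    · exact hne rfl
    · exact h1 hl
    · exact h2 hl
  · rintro rfl
    exact h1 Relation.ReflTransGen.refl

end GraphIdeal

end ToricGraph

namespace ToricGraph

/-! ### Counting generators fibre by fibre -/

section Counting

open MvPolynomial

variable {V : Type*} {G : SimpleGraph V} [Fintype V] [DecidableEq V] [DecidableRel G.Adj]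

/-- One of the two monomials involves only variables of `m`. -/
def Touches (u v m : G.edgeSet →₀ ℕ) : Prop :=
  u.support ⊆ m.support ∨ v.support ⊆ m.support

lemma Touches.support_eq (hsharp : SatisfiesSharp G) {u v m : G.edgeSet →₀ ℕ} (hne : u ≠ v)
    (hD : vdeg u = vdeg v) (hm : IsolatedMonomial m) (h : Touches u v m) :
    m.support = u.support ∨ m.support = v.support := by
  rcases h with h | h
  · exact Or.inl (Finset.Subset.antisymm
      (support_subset_of_le (hm.le_of_support_subset hsharp hD hne h)) h)
  · exact Or.inr (Finset.Subset.antisymm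
      (support_subset_of_le (hm.le_of_support_subset hsharp hD.symm hne.symm h)) h)

/-- A touched isolated monomial has the support of `u` or of `v`. Equal supports force equal
monomials; in the mixed case the pair `u`, `v` itself connects the two degrees. -/
lemma Touches.vdeg_eq (hsharp : SatisfiesSharp G) {u v m m' : G.edgeSet →₀ ℕ} (hne : u ≠ v)
    (hD : vdeg u = vdeg v) (hm : IsolatedMonomial m) (hm' : IsolatedMonomial m')
    (h : Touches u v m) (h' : Touches u v m') : vdeg m = vdeg m' := by
  rcases h.support_eq hsharp hne hD hm with h1 | h1 <;>
    rcases h'.support_eq hsharp hne hD hm' with h2 | h2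
  · rw [hm.eq_of_support_eq hm' (h1.trans h2.symm)]
  · exact hm.vdeg_eq_of_support_subset hsharp hm' hD hne h1.ge h2.ge
  · exact hm.vdeg_eq_of_support_subset hsharp hm' hD.symm hne.symm h1.ge h2.ge
  · rw [hm.eq_of_support_eq hm' (h1.trans h2.symm)]

/-- A binomial touches at most two isolated monomials. -/
lemma Touches.eq_of_three (hsharp : SatisfiesSharp G) {u v m n q : G.edgeSet →₀ ℕ} (hne : u ≠ v)
    (hD : vdeg u = vdeg v) (hm : IsolatedMonomial m) (hn : IsolatedMonomial n)
    (hq : IsolatedMonomial q) (h1 : Touches u v m) (h2 : Touches u v n) (h3 : Touches u v q) :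
    m = n ∨ m = q ∨ n = q := by
  have e1 := h1.support_eq hsharp hne hD hm
  have e2 := h2.support_eq hsharp hne hD hn
  have e3 := h3.support_eq hsharp hne hD hq
  have k1 := hm.eq_of_support_eq hn
  have k2 := hm.eq_of_support_eq hq
  have k3 := hn.eq_of_support_eq hq
  rcases e1 with e1 | e1 <;> rcases e2 with e2 | e2 <;> rcases e3 with e3 | e3 <;>
    simp_all

variable {K : Type*} [Field K]

lemma vdeg_eq_of_mem_system {S : Set (MvPolynomial G.edgeSet K)}
    (hS : IsBinomialSystem (graphIdeal K G) S) {m n : G.edgeSet →₀ ℕ}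
    (h : (monomial m 1 - monomial n 1 : MvPolynomial G.edgeSet K) ∈ S) : vdeg m = vdeg n := by
  refine sub_monomial_mem_graphIdeal (K := K).1 ?_
  rw [← hS.2]
  exact Ideal.subset_span h

/-- In a system of generators of least cardinality, two binomials of the same degree involve
three pairwise unlinked monomials. -/
lemma exists_third_unlinked {S : Finset (MvPolynomial G.edgeSet K)}
    (hS : IsBinomialSystem (graphIdeal K G) (S : Set (MvPolynomial G.edgeSet K)))
    (hcard : S.card = mu (graphIdeal K G)) {m n m' n' : G.edgeSet →₀ ℕ} (hne' : m' ≠ n')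
    (hf : (monomial m 1 - monomial n 1 : MvPolynomial G.edgeSet K) ∈ S)
    (hg : (monomial m' 1 - monomial n' 1 : MvPolynomial G.edgeSet K) ∈ S)
    (hfg : (monomial m 1 - monomial n 1 : MvPolynomial G.edgeSet K) ≠
      monomial m' 1 - monomial n' 1)
    (hD : vdeg m = vdeg m') (hunl : ¬ Linked m' n') :
    (¬ Linked m m' ∧ ¬ Linked n m') ∨ (¬ Linked m n' ∧ ¬ Linked n n') := by
  -- Otherwise each of `m'`, `n'` is linked to `m` or `n`. Modulo the other generators linked
  -- monomials of this fibre agree, and `m` agrees with `n`; so either `m'` and `n'` are linked or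
  -- their binomial is redundant.
  by_contra! hcon
  have hDf := vdeg_eq_of_mem_system hS hf
  have hDg := vdeg_eq_of_mem_system hS hg
  have hgn := notMem_span_of_card_eq_mu hS hcard hg
  set J := Ideal.span ((S : Set (MvPolynomial G.edgeSet K)) \
    {monomial m' 1 - monomial n' 1}) with hJ
  have hl : ∀ {a b : G.edgeSet →₀ ℕ}, vdeg a = vdeg m' → Linked a b →
      Ideal.Quotient.mk J (monomial a 1) = Ideal.Quotient.mk J (monomial b 1) := fun ha hab =>
    mk_eq_mk_of_mem (mem_span_diff_of_linked hS hab hne' hDg (degree_eq_of_vdeg_eq ha).le)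
  have hfJ : Ideal.Quotient.mk J (monomial m 1) = Ideal.Quotient.mk J (monomial n 1) :=
    mk_eq_mk_of_mem (Ideal.subset_span ⟨hf, hfg⟩)
  have key : ¬ Ideal.Quotient.mk J (monomial m' 1) = Ideal.Quotient.mk J (monomial n' 1) :=
    fun h => hgn (Ideal.Quotient.eq.1 h)
  obtain ⟨h1, h2⟩ := hcon
  have hDn : vdeg n = vdeg m' := hDf.symm.trans hD
  by_cases a1 : Linked m m'
  · by_cases a2 : Linked m n'
    · exact hunl (a1.symm.trans a2)
    · exact key ((hl hD a1).symm.trans (hfJ.trans (hl hDn (h2 a2))))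
  · by_cases a2 : Linked m n'
    · exact key ((hl hDn (h1 a1)).symm.trans (hfJ.symm.trans (hl hD a2)))
    · exact hunl ((h1 a1).symm.trans (h2 a2))

lemma not_linked_of_mem {S : Finset (MvPolynomial G.edgeSet K)}
    (hS : IsBinomialSystem (graphIdeal K G) (S : Set (MvPolynomial G.edgeSet K)))
    (hcard : S.card = mu (graphIdeal K G)) {m n : G.edgeSet →₀ ℕ} (hne : m ≠ n)
    (hf : (monomial m 1 - monomial n 1 : MvPolynomial G.edgeSet K) ∈ S) : ¬ Linked m n :=
  fun h => notMem_span_of_card_eq_mu hS hcard hf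
    (mem_span_diff_of_linked hS h hne (vdeg_eq_of_mem_system hS hf) le_rfl)

/-- Three unlinked monomials of the same degree account for at most two generators. -/
lemma card_le_two_of_unlinked (hsharp : SatisfiesSharp G)
    {S : Finset (MvPolynomial G.edgeSet K)}
    (hS : IsBinomialSystem (graphIdeal K G) (S : Set (MvPolynomial G.edgeSet K)))
    (hcard : S.card = mu (graphIdeal K G)) {M N : MvPolynomial G.edgeSet K → G.edgeSet →₀ ℕ}
    (hne : ∀ f ∈ S, M f ≠ N f) (hMN : ∀ f ∈ S, f = monomial (M f) 1 - monomial (N f) 1)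
    {f g h : MvPolynomial G.edgeSet K} (hf : f ∈ S) (hg : g ∈ S) (hh : h ∈ S)
    (hfg : f ≠ g) (hfh : f ≠ h) (hgh : g ≠ h) (hDg : vdeg (M g) = vdeg (M f))
    (hDh : vdeg (M h) = vdeg (M f)) : False := by
  have hv : ∀ f ∈ S, vdeg (M f) = vdeg (N f) := fun f hf =>
    vdeg_eq_of_mem_system hS (by rw [← hMN f hf]; exact hf)
  have hunl : ∀ f ∈ S, ¬ Linked (M f) (N f) := fun f hf =>
    not_linked_of_mem hS hcard (hne f hf) (by rw [← hMN f hf]; exact hf)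
  have hhn := notMem_span_of_card_eq_mu hS hcard hh
  set J := Ideal.span ((S : Set (MvPolynomial G.edgeSet K)) \ {h}) with hJ
  set φ := fun m : G.edgeSet →₀ ℕ => Ideal.Quotient.mk J (monomial m 1) with hφ
  have hφS : ∀ f ∈ S, f ≠ h → φ (M f) = φ (N f) := fun f hf hfh =>
    mk_eq_mk_of_mem (Ideal.subset_span ⟨by rw [← hMN f hf]; exact hf, by
      rw [← hMN f hf]; exact hfh⟩)
  have h3 := exists_third_unlinked hS hcard (hne g hg) (by rw [← hMN f hf]; exact hf)
    (by rw [← hMN g hg]; exact hg) (by rw [← hMN f hf, ← hMN g hg]; exact hfg) hDg.symm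
    (hunl g hg)
  have h1 := hφS f hf hfh
  have h2 := hφS g hg hgh
  -- The fibre has only three monomials, and `f`, `g` identify all of them modulo `J`; this makes
  -- `h` redundant.
  have hconst : ∀ X, vdeg X = vdeg (M f) → φ X = φ (M f) := by
    have aux : ∀ Q P, vdeg Q = vdeg (M f) → vdeg P = vdeg (M f) → ¬ Linked (M f) Q →
        ¬ Linked (N f) Q → P ≠ Q → φ P = φ Q → ∀ X, vdeg X = vdeg (M f) → φ X = φ (M f) := by
      intro Q P hQ hP l1 l2 hPQ hφPQ
      have hcase := fun X hX => eq_of_unlinked (X := X) hsharp (hv f hf) hQ.symm (hunl f hf) l1 l2 hX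
      have hφQ : φ Q = φ (M f) := by
        rcases hcase P hP with rfl | rfl | rfl
        · exact hφPQ.symm
        · rw [← hφPQ, h1]
        · exact absurd rfl hPQ
      intro X hX
      rcases hcase X hX with rfl | rfl | rfl
      · rfl
      · exact h1.symm
      · exact hφQ
    rcases h3 with ⟨l1, l2⟩ | ⟨l1, l2⟩
    · exact aux (M g) (N g) hDg ((hv g hg).symm.trans hDg) l1 l2 (hne g hg).symm h2.symm
    · exact aux (N g) (M g) ((hv g hg).symm.trans hDg) hDg l1 l2 (hne g hg) h2
  have hφh : φ (M h) = φ (N h) :=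
    (hconst _ hDh).trans (hconst _ ((hv h hh).symm.trans hDh)).symm
  refine hhn ?_
  have := Ideal.Quotient.eq.1 hφh
  rwa [← hMN h hh] at this

/-- The least number of binomial generators is at most the number of binomials generating the
ideal up to radical, if every least system of generators consists of binomials with an isolated
monomial. -/
lemma mu_le_of_radical_eq (hsharp : SatisfiesSharp G)
    (hiso : ∀ m n : G.edgeSet →₀ ℕ, m ≠ n → vdeg m = vdeg n → ¬ Linked m n →
      IsMinimalBinomial (graphIdeal K G) (monomial m 1 - monomial n 1) →
      IsolatedMonomial m ∨ IsolatedMonomial n)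
    {s : ℕ} {B : Fin s → MvPolynomial G.edgeSet K}
    (hB : ∀ i, IsBinomial (B i) ∧ B i ∈ graphIdeal K G)
    (hrad : (graphIdeal K G).radical = (Ideal.span (Set.range B)).radical) :
    mu (graphIdeal K G) ≤ s := by
  classical
  -- The set of cardinalities is nonempty because the ring is Noetherian, so `mu` is attained and is
  -- not the default value of `sInf`.
  obtain ⟨S, hS, hcard⟩ := Nat.sInf_mem (s := {s : ℕ | ∃ S : Finset (MvPolynomial G.edgeSet K),
      IsBinomialSystem (graphIdeal K G) (S : Set (MvPolynomial G.edgeSet K)) ∧ S.card = s}) (by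
    obtain ⟨S, hS⟩ := exists_finset_isBinomialSystem (span_binomials_graphIdeal (G := G) (K := K))
    exact ⟨_, S, hS, rfl⟩)
  change S.card = mu (graphIdeal K G) at hcard
  rw [← hcard]
  choose u v huv hBe using fun i => (hB i).1
  obtain rfl : B = fun i => monomial (u i) 1 - monomial (v i) 1 := funext hBe
  have hDB : ∀ i, vdeg (u i) = vdeg (v i) := fun i =>
    sub_monomial_mem_graphIdeal.1 (hB i).2
  choose! M N hne hMN using hS.1
  have hne : ∀ f ∈ S, M f ≠ N f := hne
  have hMN : ∀ f ∈ S, f = monomial (M f) 1 - monomial (N f) 1 := hMN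
  have hmem : ∀ f ∈ S, (monomial (M f) 1 - monomial (N f) 1 : MvPolynomial G.edgeSet K) ∈ S :=
    fun f hf => by rw [← hMN f hf]; exact hf
  have hv : ∀ f ∈ S, vdeg (M f) = vdeg (N f) := fun f hf => vdeg_eq_of_mem_system hS (hmem f hf)
  have hunl : ∀ f ∈ S, ¬ Linked (M f) (N f) := fun f hf =>
    not_linked_of_mem hS hcard (hne f hf) (hmem f hf)
  have htouch : ∀ m, IsolatedMonomial m → ∃ i, Touches (u i) (v i) m := by
    intro m hm
    obtain ⟨n, hn, hnm⟩ := hm.exists_ne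
    refine exists_support_subset hrad (sub_monomial_mem_graphIdeal.2 hn.symm) fun hsub => ?_
    have hn0 := ne_zero_of_vdeg hn hnm
    obtain ⟨e, he⟩ := Finsupp.ne_iff.1 hn0
    have h1 := hm.disjoint n hn hnm e
    have h2 := Finsupp.mem_support_iff.1 (hsub (Finsupp.mem_support_iff.2 he))
    simp only [Finsupp.coe_zero, Pi.zero_apply] at he
    tauto
  -- `T b` collects the given binomials that touch an isolated monomial of the fibre `b`; these sets
  -- are disjoint, and it suffices to bound the generators in each fibre by `T b`.
  set T : (V → ℕ) → Finset (Fin s) := fun b =>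
    Finset.univ.filter fun i => ∃ m, IsolatedMonomial m ∧ vdeg m = b ∧ Touches (u i) (v i) m with hT
  have hTdis : ∀ b b', b ≠ b' → Disjoint (T b) (T b') := by
    intro b b' hbb
    rw [Finset.disjoint_left]
    intro i hi hi'
    rw [hT, Finset.mem_filter] at hi hi'
    obtain ⟨-, m, hm, rfl, h1⟩ := hi
    obtain ⟨-, m', hm', rfl, h2⟩ := hi'
    exact hbb (h1.vdeg_eq hsharp (huv i) (hDB i) hm hm' h2)
  have hTmem : ∀ m, IsolatedMonomial m → ∃ i ∈ T (vdeg m), Touches (u i) (v i) m := by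
    intro m hm
    obtain ⟨i, hi⟩ := htouch m hm
    exact ⟨i, Finset.mem_filter.2 ⟨Finset.mem_univ i, m, hm, rfl, hi⟩, hi⟩
  have hfib : ∀ b ∈ S.image fun f => vdeg (M f),
      (S.filter fun f => vdeg (M f) = b).card ≤ (T b).card := by
    intro b hb
    obtain ⟨f, hf, rfl⟩ := Finset.mem_image.1 hb
    by_cases h1 : (S.filter fun g => vdeg (M g) = vdeg (M f)).card ≤ 1
    · refine h1.trans (Finset.card_pos.2 ?_)
      rcases hiso (M f) (N f) (hne f hf) (hv f hf) (hunl f hf)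
        (isMinimalBinomial_of_card_eq_mu hS hcard (hmem f hf)) with h | h
      · obtain ⟨i, hi, -⟩ := hTmem _ h
        exact ⟨i, hi⟩
      · obtain ⟨i, hi, -⟩ := hTmem _ h
        rw [← hv f hf] at hi
        exact ⟨i, hi⟩
    · have h2 : (S.filter fun g => vdeg (M g) = vdeg (M f)).card ≤ 2 := by
        by_contra! h3
        obtain ⟨f₁, h₁, f₂, h₂, f₃, h₃, h12, h13, h23⟩ := Finset.two_lt_card.1 h3
        rw [Finset.mem_filter] at h₁ h₂ h₃
        exact card_le_two_of_unlinked hsharp hS hcard hne hMN h₁.1 h₂.1 h₃.1 h12 h13 h23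
          (h₂.2.trans h₁.2.symm) (h₃.2.trans h₁.2.symm)
      refine h2.trans ?_
      obtain ⟨f₁, h₁, f₂, h₂, h12⟩ := Finset.one_lt_card.1 (not_le.1 h1)
      rw [Finset.mem_filter] at h₁ h₂
      -- All three monomials are isolated, and a single binomial touches at most two of them.
      have three : ∀ Q, vdeg (M f₁) = vdeg Q → ¬ Linked (M f₁) Q → ¬ Linked (N f₁) Q →
          2 ≤ (T (vdeg (M f))).card := by
        intro Q hQ l1 l2
        have l0 := hunl _ h₁.1
        have hvf := hv _ h₁.1
        have i1 := isolatedMonomial_of_unlinked hsharp hvf hQ l0 l1 l2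
        have i2 := isolatedMonomial_of_unlinked hsharp hvf.symm (hvf.symm.trans hQ)
          (fun h => l0 h.symm) l2 l1
        have i3 := isolatedMonomial_of_unlinked hsharp hQ.symm (hQ.symm.trans hvf)
          (fun h => l1 h.symm) (fun h => l2 h.symm) l0
        obtain ⟨j₁, hj₁, t₁⟩ := hTmem _ i1
        obtain ⟨j₂, hj₂, t₂⟩ := hTmem _ i2
        obtain ⟨j₃, hj₃, t₃⟩ := hTmem _ i3
        rw [← hvf, h₁.2] at hj₂
        rw [← hQ, h₁.2] at hj₃
        rw [h₁.2] at hj₁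
        by_contra! hlt
        have hle := Finset.card_le_one.1 (Nat.le_of_lt_succ hlt)
        rw [← hle _ hj₁ _ hj₂] at t₂
        rw [← hle _ hj₁ _ hj₃] at t₃
        rcases t₁.eq_of_three hsharp (huv j₁) (hDB j₁) i1 i2 i3 t₂ t₃ with h | h | h
        · exact hne _ h₁.1 h
        · exact l1 (h ▸ Relation.ReflTransGen.refl)
        · exact l2 (h ▸ Relation.ReflTransGen.refl)
      rcases exists_third_unlinked hS hcard (hne _ h₂.1) (hmem _ h₁.1) (hmem _ h₂.1)
        (by rw [← hMN _ h₁.1, ← hMN _ h₂.1]; exact h12) (h₁.2.trans h₂.2.symm)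
        (hunl _ h₂.1) with ⟨l1, l2⟩ | ⟨l1, l2⟩
      · exact three _ (h₁.2.trans h₂.2.symm) l1 l2
      · exact three _ ((h₁.2.trans h₂.2.symm).trans (hv _ h₂.1)) l1 l2
  calc S.card = ∑ b ∈ S.image fun f => vdeg (M f), (S.filter fun f => vdeg (M f) = b).card :=
        Finset.card_eq_sum_card_image _ _
    _ ≤ ∑ b ∈ S.image fun f => vdeg (M f), (T b).card := Finset.sum_le_sum hfib
    _ = ((S.image fun f => vdeg (M f)).biUnion T).card :=
        (Finset.card_biUnion fun b _ b' _ hbb => hTdis b b' hbb).symm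
    _ ≤ (Finset.univ : Finset (Fin s)).card := Finset.card_le_univ _
    _ = s := by simp

/-- There are always `mu` binomials generating the ideal up to radical. -/
lemma exists_radical_eq_of_mu :
    ∃ B : Fin (mu (graphIdeal K G)) → MvPolynomial G.edgeSet K,
      (∀ i, IsBinomial (B i) ∧ B i ∈ graphIdeal K G) ∧
        (graphIdeal K G).radical = (Ideal.span (Set.range B)).radical := by
  obtain ⟨S, hS, hcard⟩ := Nat.sInf_mem (s := {s : ℕ | ∃ S : Finset (MvPolynomial G.edgeSet K),
      IsBinomialSystem (graphIdeal K G) (S : Set (MvPolynomial G.edgeSet K)) ∧ S.card = s}) (by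
    obtain ⟨S, hS⟩ := exists_finset_isBinomialSystem (span_binomials_graphIdeal (G := G) (K := K))
    exact ⟨_, S, hS, rfl⟩)
  change S.card = mu (graphIdeal K G) at hcard
  rw [← hcard]
  refine ⟨fun i => (S.equivFin.symm i : MvPolynomial G.edgeSet K), fun i => ⟨hS.1 _ ?_, ?_⟩, ?_⟩
  · exact (S.equivFin.symm i).2
  · have h : (S.equivFin.symm i : MvPolynomial G.edgeSet K) ∈
        Ideal.span (S : Set (MvPolynomial G.edgeSet K)) :=
      Ideal.subset_span (S.equivFin.symm i).2
    rwa [hS.2] at h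
  · have : Set.range (fun i => (S.equivFin.symm i : MvPolynomial G.edgeSet K)) =
        (S : Set (MvPolynomial G.edgeSet K)) := by
      ext f
      constructor
      · rintro ⟨i, rfl⟩
        exact (S.equivFin.symm i).2
      · intro hf
        exact ⟨S.equivFin ⟨f, hf⟩, by simp⟩
    rw [this, hS.2]

end Counting

end ToricGraph

/-! ### Conclusion -/

theorem theorem3p14 {V K : Type*} [Fintype V] [DecidableEq V] [Field K]
    (G : SimpleGraph V) [DecidableRel G.Adj] (hconn : G.Connected)
    (hsharp : ToricGraph.SatisfiesSharp G)
    (hmin : ¬ ∃ (a : V) (w : G.Walk a a), Even w.length ∧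
      ToricGraph.IsMinimalBinomial (ToricGraph.graphIdeal K G) (ToricGraph.walkBinomial K w) ∧
      ToricGraph.IsCircuit (ToricGraph.edgeVectors G) (ToricGraph.walkBinomial K w) ∧
      ToricGraph.IsSquarefreeExp (ToricGraph.walkPlus w) ∧
      ToricGraph.IsSquarefreeExp (ToricGraph.walkMinus w) ∧
      ¬ ToricGraph.IsIndispensableMonomial (ToricGraph.graphIdeal K G) (ToricGraph.walkPlus w) ∧
      ¬ ToricGraph.IsIndispensableMonomial (ToricGraph.graphIdeal K G)
        (ToricGraph.walkMinus w)) :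
    ToricGraph.bar (ToricGraph.graphIdeal K G) = ToricGraph.mu (ToricGraph.graphIdeal K G) := by
  obtain ⟨B₀, hB₀⟩ := ToricGraph.exists_radical_eq_of_mu (G := G) (K := K)
  refine le_antisymm (Nat.sInf_le ⟨B₀, hB₀⟩) ?_
  obtain ⟨B, hB, hrad⟩ := Nat.sInf_mem (s := {s : ℕ | ∃ B : Fin s → MvPolynomial G.edgeSet K,
    (∀ i, ToricGraph.IsBinomial (B i) ∧ B i ∈ ToricGraph.graphIdeal K G) ∧
      (ToricGraph.graphIdeal K G).radical = (Ideal.span (Set.range B)).radical}) ⟨_, B₀, hB₀⟩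
  refine ToricGraph.mu_le_of_radical_eq hsharp ?_ hB hrad
  intro m n hne hD hunl hminimal
  have hpair := ToricGraph.circlePair_of_not_linked hsharp hD hunl
  have hone := hpair.add_le_one
  have hcirc := hpair.isCircuit (K := K) (ToricGraph.ne_zero_of_vdeg hD hne)
  obtain ⟨a, w, he, -, rfl, rfl⟩ := hpair.exists_walk
  -- The pair is a squarefree circuit and a minimal binomial. If neither monomial is isolated, then
  -- neither is indispensable, and the walk `w` is excluded by `hmin`.
  by_contra! hiso
  refine hmin ⟨a, w, he, hminimal, hcirc, fun e => ?_, fun e => ?_, fun hind => ?_, fun hind => ?_⟩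
  · have := hone e
    omega
  · have := hone e
    omega
  · exact hiso.1 ⟨fun e => by have := hone e; omega,
      fun k hk hkm e => ToricGraph.disjoint_of_indispensable hind hk hkm e, _, hD.symm, hne.symm⟩
  · exact hiso.2 ⟨fun e => by have := hone e; omega,
      fun k hk hkm e => ToricGraph.disjoint_of_indispensable hind hk hkm e, _, hD, hne⟩
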